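/- Let $\mathbb S=\mathbb R/\mathbb Z$, parametrized by $x\in[0,1)$, and let $H^1_0=H^1_0(\mathbb S,\mathbb R)$ be the Hilbert space of real functions $f$ on $\mathbb S$ such that $f$ and its weak derivative $Df$ lie in $L^2(\mathbb S)$ and (the continuous representative of) $f$ satisfies $f(0)=0$, with norm $\|f\|_{H^1}^2=\|f\|_{L^2}^2+\|Df\|_{L^2}^2$. For $p=(r,\lambda,\mu)\in(0,\tfrac12]\times\mathbb R\times\mathbb R$ let $W_r(x)=1$ if $\min(x,1-x)\le r$ and $W_r(x)=0$ otherwise ($x\in[0,1)$, extended periodically), and for a phase function $\Psi$ with $\Psi(0)=0$ let $$\begin{aligned}F(\Psi,p)(x)&=\int_{\mathbb S}W_r(x-y)\sin(\Psi(y)-\Psi(x))\,dy-\int_{\mathbb S}W_r(y)\sin\Psi(y)\,dy\\ &+\lambda\Big[\int_{\mathbb S}\int_{\mathbb S}W_r(z+y-2x)\sin(\Psi(z)+\Psi(y)-2\Psi(x))\,dy\,dz-\int_{\mathbb S}\int_{\mathbb S}W_r(z+y)\sin(\Psi(z)+\Psi(y))\,dy\,dz\Big]\\ &+\mu\Big[\int_{\mathbb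 S}\int_{\mathbb S}\int_{\mathbb S}W_r(z-y+w-x)\sin(\Psi(z)-\Psi(y)+\Psi(w)-\Psi(x))\,dw\,dy\,dz\\ &\qquad-\int_{\mathbb S}\int_{\mathbb S}\int_{\mathbb S}W_r(z-y+w)\sin(\Psi(z)-\Psi(y)+\Psi(w))\,dw\,dy\,dz\Big].\end{aligned}$$ For an integer $q\ge0$ let $\Psi^q(x)=2\pi qx$ ($x\in[0,1)$) be the $q$-twisted state and $F^q(v,p)=F(\Psi^q+v,p)$ for $v\in H^1_0$ (so $F^0=F$ on $H^1_0$). Then, for every such $q$ and $p$: 1. $F^q(\cdot,p)$ maps $H^1_0$ into $H^1_0$ and is $n$ times Fréchet differentiable for every $n\ge 0$. 2. With $\tilde\Psi=\Psi^q+v$, the $n$-th Fréchet derivative of $F^q(\cdot,p)$ at $v\in H^1_0$ is the bounded $n$-linear operator $A^{\tilde\Psi}:(H^1_0)^n\to H^1_0$ given by $$\begin{aligned}&(A^{\tilde\Psi}[\eta_1,\dots,\eta_n])(x)\\&=\int_{\mathbb S}W_r(x-y)\prod_{i=1}^n(\eta_i(y)-\eta_i(x))\sin^{[n]}(\tilde\Psi(y)-\tilde\Psi(x))\,dy-\int_{\mathbb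 S}W_r(y)\prod_{i=1}^n\eta_i(y)\sin^{[n]}(\tilde\Psi(y))\,dy\\ &+\lambda\Big[\int_{\mathbb S}\int_{\mathbb S}W_r(z+y-2x)\prod_{i=1}^n(\eta_i(z)+\eta_i(y)-2\eta_i(x))\sin^{[n]}(\tilde\Psi(z)+\tilde\Psi(y)-2\tilde\Psi(x))\,dy\,dz\\ &\qquad-\int_{\mathbb S}\int_{\mathbb S}W_r(z+y)\prod_{i=1}^n(\eta_i(z)+\eta_i(y))\sin^{[n]}(\tilde\Psi(z)+\tilde\Psi(y))\,dy\,dz\Big]\\ &+\mu\Big[\int_{\mathbb S}\int_{\mathbb S}\int_{\mathbb S}W_r(z-y+w-x)\prod_{i=1}^n(\eta_i(z)-\eta_i(y)+\eta_i(w)-\eta_i(x))\sin^{[n]}(\tilde\Psi(z)-\tilde\Psi(y)+\tilde\Psi(w)-\tilde\Psi(x))\,dw\,dy\,dz\\ &\qquad-\int_{\mathbb S}\int_{\mathbb S}\int_{\mathbb S}W_r(z-y+w)\prod_{i=1}^n(\eta_i(z)-\eta_i(y)+\eta_i(w))\sin^{[n]}(\tilde\Psi(z)-\tilde\Psi(y)+\tilde\Psi(w))\,dw\,dy\,dz\Big],\end{aligned}$$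 where $\sin^{[n]}$ is the $n$-th derivative of $\sin$. 3. There is a constant $C$ depending only on $n,\lambda,\mu$ such that $$\|A^{\tilde\Psi}[\eta_1,\dots,\eta_n]\|_{H^1}^2\le C\,\big(1+\|\tilde\Psi\|_{H^1(0,1)}^2\big)\prod_{i=1}^n\|\eta_i\|_{H^1}^2\qquad(\eta_1,\dots,\eta_n\in H^1_0),$$ where $\|\tilde\Psi\|_{H^1(0,1)}^2=\|\Psi^q+v\|_{L^2}^2+\|2\pi q+Dv\|_{L^2}^2$. If $\lambda=\mu=0$, then $$\|A^{\tilde\Psi}[\eta_1,\dots,\eta_n]\|_{H^1}^2\le\Big(4+(n+3)\big(n+2+\|\tilde\Psi\|_{H^1(0,1)}^2\big)\Big)\prod_{i=1}^n\|\eta_i\|_{H^1}^2 .$$ 4. The functions $u_k(x)=\sin(2\pi kx)$ and $w_k(x)=1-\cos(2\pi kx)$, $k\ge1$, in the order $u_1,w_1,u_2,w_2,\dots$, form a Schauder basis of $H^1_0$, and the linearization $F^q_v(0,p)$ at $\Psi^q$ is diagonal on it: for all $k\ge1$, $F^q_v(0,p)[u_k]=c_1(q,k,p)u_k$ and $F^q_v(0,p)[w_k]=c_1(q,k,p)w_k$,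 where $$c_1(q,k,p)=\tfrac14\big(\hat W_r(q-k)+\hat W_r(q+k)-2\hat W_r(q)-(4\lambda+2\mu)\hat W_r(q)\big),$$ $\hat W_r(0)=4r$ and $\hat W_r(m)=\frac{2\sin(2\pi mr)}{\pi m}$ for integers $m\neq0$. -/

import Mathlib

open MeasureTheory
open scoped ContDiff

noncomputable section

/-- Square-integrable real functions on the circle `ℝ / ℤ` (with Lebesgue measure, total mass 1). -/
abbrev CircleL2 : Type := Lp ℝ 2 (volume : Measure UnitAddCircle)

/-- `g` is the weak derivative of `f` on the circle: `∫ f φ' = - ∫ g φ` for all smooth test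
functions `φ` on the circle. Smoothness and the derivative `φ'` are read off from the 1-periodic
pullback `t ↦ φ t` to the real line. -/
def IsWeakDeriv (f g : CircleL2) : Prop :=
  ∀ φ φ' : UnitAddCircle → ℝ,
    ContDiff ℝ ∞ (fun t : ℝ => φ (t : UnitAddCircle)) →
    (∀ t : ℝ, HasDerivAt (fun s : ℝ => φ (s : UnitAddCircle)) (φ' (t : UnitAddCircle)) t) →
    ∫ x, f x * φ' x = - ∫ x, g x * φ x

/-- The almost-everywhere class `f` has a continuous representative that vanishes at `0`. -/
def HasContRepZero (f : CircleL2) : Prop :=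
  ∃ c : C(UnitAddCircle, ℝ), f =ᵐ[volume] c ∧ c 0 = 0

lemma continuous_of_pullback {φ : UnitAddCircle → ℝ}
    (h : Continuous (fun t : ℝ => φ (t : UnitAddCircle))) : Continuous φ :=
  (QuotientAddGroup.isQuotientMap_mk (N := AddSubgroup.zmultiples (1 : ℝ))).continuous_iff.2 h

lemma integrable_L2_mul_cont (f : CircleL2) {φ : UnitAddCircle → ℝ} (h : Continuous φ) :
    Integrable (fun x => f x * φ x) := by
  have h1 : Integrable (f : UnitAddCircle → ℝ) := (Lp.memLp f).integrable (by norm_num)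
  obtain ⟨C, hC⟩ := (isCompact_range h).isBounded.exists_norm_le
  exact h1.mul_bdd (c := C) h.aestronglyMeasurable
    (Filter.Eventually.of_forall fun x => hC _ ⟨x, rfl⟩)

lemma continuous_test_deriv {φ φ' : UnitAddCircle → ℝ}
    (h : ContDiff ℝ ∞ (fun t : ℝ => φ (t : UnitAddCircle)))
    (h' : ∀ t : ℝ, HasDerivAt (fun s : ℝ => φ (s : UnitAddCircle)) (φ' (t : UnitAddCircle)) t) :
    Continuous φ' := by
  apply continuous_of_pullback
  have e : (fun t : ℝ => φ' (t : UnitAddCircle)) = deriv (fun t : ℝ => φ (t : UnitAddCircle)) :=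
    funext fun t => (h' t).deriv.symm
  rw [e]
  exact h.continuous_deriv (by simp)

lemma IsWeakDeriv.add {f g f₁ g₁ : CircleL2} (h : IsWeakDeriv f g) (h₁ : IsWeakDeriv f₁ g₁) :
    IsWeakDeriv (f + f₁) (g + g₁) := by
  intro φ φ' hφ hφ'
  have c := continuous_of_pullback hφ.continuous
  have c' := continuous_test_deriv hφ hφ'
  have e1 : ∫ x, (f + f₁ : CircleL2) x * φ' x = ∫ x, (f x * φ' x + f₁ x * φ' x) := by
    apply integral_congr_ae
    filter_upwards [Lp.coeFn_add f f₁] with x hx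
    rw [hx, Pi.add_apply, add_mul]
  have e2 : ∫ x, (g + g₁ : CircleL2) x * φ x = ∫ x, (g x * φ x + g₁ x * φ x) := by
    apply integral_congr_ae
    filter_upwards [Lp.coeFn_add g g₁] with x hx
    rw [hx, Pi.add_apply, add_mul]
  rw [e1, e2, integral_add (integrable_L2_mul_cont f c') (integrable_L2_mul_cont f₁ c'),
    integral_add (integrable_L2_mul_cont g c) (integrable_L2_mul_cont g₁ c),
    h φ φ' hφ hφ', h₁ φ φ' hφ hφ']
  ring

lemma IsWeakDeriv.smul {f g : CircleL2} (a : ℝ) (h : IsWeakDeriv f g) :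
    IsWeakDeriv (a • f) (a • g) := by
  intro φ φ' hφ hφ'
  have e1 : ∫ x, (a • f : CircleL2) x * φ' x = ∫ x, a * (f x * φ' x) := by
    apply integral_congr_ae
    filter_upwards [Lp.coeFn_smul a f] with x hx
    rw [hx, Pi.smul_apply, smul_eq_mul, mul_assoc]
  have e2 : ∫ x, (a • g : CircleL2) x * φ x = ∫ x, a * (g x * φ x) := by
    apply integral_congr_ae
    filter_upwards [Lp.coeFn_smul a g] with x hx
    rw [hx, Pi.smul_apply, smul_eq_mul, mul_assoc]
  rw [e1, e2, integral_const_mul, integral_const_mul, h φ φ' hφ hφ']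
  ring

/-- The space `H¹₀(𝕊, ℝ)` as a subspace of `L² × L²`: pairs `(f, Df)` of a function and its weak
derivative such that (the continuous representative of) `f` vanishes at `0`. The ambient
`WithLp 2` makes the inner product `∫ f g + ∫ Df Dg`. -/
def h10Submodule : Submodule ℝ (WithLp 2 (CircleL2 × CircleL2)) where
  carrier := {u | IsWeakDeriv u.fst u.snd ∧ HasContRepZero u.fst}
  zero_mem' := by
    have h0 : ((0 : CircleL2) : UnitAddCircle → ℝ) =ᵐ[volume] 0 := Lp.coeFn_zero ℝ 2 _
    have key : ∀ ψ : UnitAddCircle → ℝ, ∫ x, (0 : CircleL2) x * ψ x = 0 := by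
      intro ψ
      rw [← integral_zero UnitAddCircle ℝ]
      apply integral_congr_ae
      filter_upwards [h0] with x hx
      rw [hx]
      simp
    refine ⟨?_, ?_⟩
    · intro φ φ' _ _
      rw [WithLp.zero_fst, WithLp.zero_snd, key, key, neg_zero]
    · exact ⟨0, by rw [WithLp.zero_fst]; exact h0, rfl⟩
  add_mem' := by
    rintro u v ⟨hu, c, hc, hc0⟩ ⟨hv, d, hd, hd0⟩
    refine ⟨hu.add hv, c + d, ?_, by simp [hc0, hd0]⟩
    rw [WithLp.add_fst]
    filter_upwards [Lp.coeFn_add u.fst v.fst, hc, hd] with x hx h1 h2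
    rw [hx, Pi.add_apply, h1, h2]
    rfl
  smul_mem' := by
    rintro a u ⟨hu, c, hc, hc0⟩
    refine ⟨hu.smul a, a • c, ?_, by simp [hc0]⟩
    rw [WithLp.smul_fst]
    filter_upwards [Lp.coeFn_smul a u.fst, hc] with x hx h1
    rw [hx, Pi.smul_apply, h1]
    rfl

/-- The Sobolev space `H¹₀(𝕊, ℝ)`. -/
abbrev H10 : Type := ↥h10Submodule

/-- The (unique) continuous representative of an element of `H¹₀`. -/
def H10.rep (u : H10) : C(UnitAddCircle, ℝ) := u.2.2.choose

/-- The weak derivative of an element of `H¹₀`. -/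
def H10.weakD (u : H10) : CircleL2 := u.1.snd

lemma H10.coe_ae_eq_rep (u : H10) : u.1.fst =ᵐ[volume] u.rep := u.2.2.choose_spec.1

lemma H10.rep_zero (u : H10) : u.rep 0 = 0 := u.2.2.choose_spec.2

lemma H10.norm_sq (u : H10) : ‖u‖ ^ 2 = (∫ x, u.rep x ^ 2) + ∫ x, u.weakD x ^ 2 := by
  have key : ∀ f : CircleL2, inner ℝ f f = ∫ x, f x ^ 2 := by
    intro f
    rw [L2.inner_def]
    congr 1
    ext x
    simp [pow_two]
  rw [← real_inner_self_eq_norm_sq, Submodule.coe_inner, WithLp.prod_inner_apply]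
  change inner ℝ u.1.fst u.1.fst + inner ℝ u.1.snd u.1.snd = _
  rw [key, key]
  congr 1
  apply integral_congr_ae
  filter_upwards [u.coe_ae_eq_rep] with x hx
  rw [hx]

/-- The coupling function `W_r` on the circle: `1` within distance `r` of `0`, else `0`. -/
def couplingW (r : ℝ) (x : UnitAddCircle) : ℝ := if ‖x‖ ≤ r then 1 else 0

lemma couplingW_coe (r x : ℝ) :
    couplingW r (x : UnitAddCircle) = if min (Int.fract x) (1 - Int.fract x) ≤ r then 1 else 0 := by
  rw [couplingW, UnitAddCircle.norm_eq, abs_sub_round_eq_min]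

/-- The coefficients `Ŵ_r(k)`, for all integers `k` (they are even in `k`). -/
def couplingCoeff (r : ℝ) (k : ℤ) : ℝ :=
  if k = 0 then 4 * r else 2 * Real.sin (2 * Real.pi * k * r) / (Real.pi * k)

/-- The `q`-twisted state `Ψ^q(x) = 2πqx`, with the circle parametrized by `x ∈ [0, 1)`. -/
def twistedState (q : ℕ) (x : UnitAddCircle) : ℝ :=
  2 * Real.pi * q * (AddCircle.equivIco 1 0 x : ℝ)

/-- The state `Ψ^q + v`: the `q`-twisted state perturbed by `v ∈ H¹₀`. -/
def perturbedState (q : ℕ) (v : H10) (x : UnitAddCircle) : ℝ := twistedState q x + v.rep x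

/-- The squared `H¹(0,1)` norm of `Ψ^q + v`, whose derivative is `2πq + Dv`. -/
def perturbedStateNormSq (q : ℕ) (v : H10) : ℝ :=
  (∫ x, perturbedState q v x ^ 2) + ∫ x, (2 * Real.pi * q + v.weakD x) ^ 2

/-- The right-hand side `F(Ψ, (r, lam, mu))` of the phase-difference system, at the point `x`. -/
def phaseRHS (r lam mu : ℝ) (Ψ : UnitAddCircle → ℝ) (x : UnitAddCircle) : ℝ :=
  (∫ y, couplingW r (x - y) * Real.sin (Ψ y - Ψ x))
    - (∫ y, couplingW r y * Real.sin (Ψ y))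
  + lam * ((∫ z, ∫ y, couplingW r (z + y - 2 • x) * Real.sin (Ψ z + Ψ y - 2 * Ψ x))
    - ∫ z, ∫ y, couplingW r (z + y) * Real.sin (Ψ z + Ψ y))
  + mu * ((∫ z, ∫ y, ∫ w,
        couplingW r (z - y + w - x) * Real.sin (Ψ z - Ψ y + Ψ w - Ψ x))
    - ∫ z, ∫ y, ∫ w, couplingW r (z - y + w) * Real.sin (Ψ z - Ψ y + Ψ w))

/-- The value `(A^Ψ[η₁, …, η_n])(x)` of the `n`-linear integral operator. -/
def multilinearOp (r lam mu : ℝ) (Ψ : UnitAddCircle → ℝ) {n : ℕ}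
    (η : Fin n → UnitAddCircle → ℝ) (x : UnitAddCircle) : ℝ :=
  (∫ y, couplingW r (x - y) * (∏ i, (η i y - η i x)) * iteratedDeriv n Real.sin (Ψ y - Ψ x))
    - (∫ y, couplingW r y * (∏ i, η i y) * iteratedDeriv n Real.sin (Ψ y))
  + lam * ((∫ z, ∫ y, couplingW r (z + y - 2 • x) * (∏ i, (η i z + η i y - 2 * η i x))
        * iteratedDeriv n Real.sin (Ψ z + Ψ y - 2 * Ψ x))
    - ∫ z, ∫ y, couplingW r (z + y) * (∏ i, (η i z + η i y))
        * iteratedDeriv n Real.sin (Ψ z + Ψ y))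
  + mu * ((∫ z, ∫ y, ∫ w, couplingW r (z - y + w - x)
        * (∏ i, (η i z - η i y + η i w - η i x))
        * iteratedDeriv n Real.sin (Ψ z - Ψ y + Ψ w - Ψ x))
    - ∫ z, ∫ y, ∫ w, couplingW r (z - y + w) * (∏ i, (η i z - η i y + η i w))
        * iteratedDeriv n Real.sin (Ψ z - Ψ y + Ψ w))

/-- The eigenvalues `c₁(q, k, (r, lam, mu))`. -/
def eigenvalueC1 (q k : ℤ) (r lam mu : ℝ) : ℝ :=
  (1 / 4) * (couplingCoeff r (q - k) + couplingCoeff r (q + k) - 2 * couplingCoeff r q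
    - (4 * lam + 2 * mu) * couplingCoeff r q)

end

/-! Each of the three interactions has the form `∫ W_r(σ) sin(Σⱼ cⱼ Ψ(yⱼ))` with `Σⱼ cⱼ = 0`, one of
the points `yⱼ` being `x`. Substituting `yⱼ = x + τⱼ(w)` and integrating over the probability space
of the `w` makes the discontinuous kernel independent of `x`. Modulo `2π` the twisted state is
additive, so with zero coefficient sum its contribution is also independent of `x`. What remains is
`∫ k(w) sin(θ(w) + Σⱼ cⱼ v(x + τⱼ(w))) dw` with `k` and `θ` only measurable. This is a
`ShiftInteraction`; the terms subtracted in `F` are its value at `x = 0`.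

An element of `H¹₀` is the primitive, vanishing at `0`, of a mean-zero `L²` function. The operator
is therefore built from its `x`-derivative: form the `L²` function `k cos(θ + comb v) · comb (Dv)`
on parameter space times circle, average over the parameter, take the primitive
(`rep_primL_averageL`). Each stage is bounded linear or bilinear, except `v ↦ cos (comb v), sin
(comb v)` into continuous functions, which is smooth because the exponential of the Banach algebra
`C(X, ℂ)` is analytic (`contDiff_expI`). Hence smoothness in the `H¹` norm comes without remainder
estimates.

Once smoothness is known, point evaluation is continuous on `H¹₀`, so the derivatives can be
identified pointwise by differentiating under the integral (`rep_iteratedFDeriv_op`). The bounds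
follow from the product rule: one factor in `L²`, the others in sup norm. The explicit constant for
pairwise coupling uses two sharper facts, an oscillation bound with factor `1/2` and the
orthogonality of a mean-zero function to its translates.

The Schauder basis is the image under the primitive operator of the real Fourier basis of `L²`,
whose constant mode is annihilated. The eigenvalues come from addition formulas and the cosine
coefficients of `W_r`, with Fubini and translation invariance separating the variables in the
higher-order terms. -/

noncomputable section

/-! ### Absolutely continuous primitives on the line -/

/-- `f` is locally absolutely continuous on the line, with almost-everywhere derivative `g`. -/
structure IsPrim (f g : ℝ → ℝ) : Prop where
  absCont : ∀ a b, AbsolutelyContinuousOnInterval f a b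
  deriv_ae : ∀ᵐ t, HasDerivAt f (g t) t

namespace IsPrim

lemma intervalIntegrable {f g : ℝ → ℝ} (h : IsPrim f g) (a b : ℝ) :
    IntervalIntegrable g volume a b := by
  refine (h.absCont a b).intervalIntegrable_deriv.congr_ae ?_
  exact ae_restrict_of_ae (h.deriv_ae.mono fun t ht => ht.deriv)

lemma integral_eq {f g : ℝ → ℝ} (h : IsPrim f g) (a b : ℝ) :
    ∫ t in a..b, g t = f b - f a := by
  rw [← (h.absCont a b).integral_deriv_eq_sub]
  exact intervalIntegral.integral_congr_ae (h.deriv_ae.mono fun t ht _ => ht.deriv.symm)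

lemma of_integral {g : ℝ → ℝ} (hg : LocallyIntegrable g) (c : ℝ) :
    IsPrim (fun t => ∫ s in c..t, g s) g where
  absCont a b := by
    have h1 : IntervalIntegrable g volume (min a (min b c)) (max a (max b c)) :=
      (hg.integrableOn_isCompact isCompact_uIcc).intervalIntegrable
    refine (h1.absolutelyContinuousOnInterval_intervalIntegral (c := c) ?_).mono ?_
    · rw [Set.mem_uIcc]; left; simp
    · apply Set.uIcc_subset_uIcc <;> (rw [Set.mem_uIcc]; left; simp)
  deriv_ae := (_root_.LocallyIntegrable.ae_hasDerivAt_integral hg).mono fun t ht => ht c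

lemma congr {f f' g g' : ℝ → ℝ} (h : IsPrim f g) (hf : ∀ t, f' t = f t) (hg : ∀ t, g' t = g t) :
    IsPrim f' g' := by
  obtain rfl : f' = f := funext hf
  obtain rfl : g' = g := funext hg
  exact h

lemma congr_ae {f g g' : ℝ → ℝ} (h : IsPrim f g) (hg : g' =ᵐ[volume] g) : IsPrim f g' :=
  ⟨h.absCont, by filter_upwards [h.deriv_ae, hg] with t h1 h2; rwa [h2]⟩

/-- Translating a finite disjoint family of intervals by `τ` preserves disjointness and total
length, so the same `δ` serves. -/
lemma comp_add {f g : ℝ → ℝ} (h : IsPrim f g) (τ : ℝ) :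
    IsPrim (fun t => f (t + τ)) (fun t => g (t + τ)) where
  absCont a b := by
    rw [absolutelyContinuousOnInterval_iff]
    intro ε hε
    obtain ⟨δ, hδ, H⟩ := (absolutelyContinuousOnInterval_iff _ _ _).1
      (h.absCont (a + τ) (b + τ)) ε hε
    refine ⟨δ, hδ, fun E hE hlt => ?_⟩
    refine H (E.1, fun i => ((E.2 i).1 + τ, (E.2 i).2 + τ)) ⟨fun i hi => ?_, ?_⟩ (by simpa using hlt)
    · have := hE.1 i hi
      simp only [Set.mem_uIcc] at this ⊢
      constructor
      · rcases this.1 with h | h <;> [left; right] <;> constructor <;> linarith [h.1, h.2]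
      · rcases this.2 with h | h <;> [left; right] <;> constructor <;> linarith [h.1, h.2]
    · intro i hi j hj hij
      have := hE.2 hi hj hij
      simp only [Function.onFun, Set.disjoint_left, Set.mem_uIoc] at this ⊢
      intro x hx hx'
      refine this (a := x - τ) ?_ ?_
      · rcases hx with h | h <;> [left; right] <;> constructor <;> linarith [h.1, h.2]
      · rcases hx' with h | h <;> [left; right] <;> constructor <;> linarith [h.1, h.2]
  deriv_ae := by
    have := (measurePreserving_add_right volume τ).quasiMeasurePreserving.ae h.deriv_ae
    filter_upwards [this] with t ht
    exact ht.comp_add_const t τ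

lemma const (c : ℝ) : IsPrim (fun _ => c) (fun _ => 0) where
  absCont _ _ := (contDiff_const.contDiffOn).absolutelyContinuousOnInterval
  deriv_ae := Filter.Eventually.of_forall fun t => hasDerivAt_const t c

lemma of_contDiff {f f' : ℝ → ℝ} (h : ContDiff ℝ 1 f) (h' : ∀ t, HasDerivAt f (f' t) t) :
    IsPrim f f' where
  absCont _ _ := h.contDiffOn.absolutelyContinuousOnInterval
  deriv_ae := Filter.Eventually.of_forall h'

lemma add {f g f₁ g₁ : ℝ → ℝ} (h : IsPrim f g) (h₁ : IsPrim f₁ g₁) :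
    IsPrim (fun t => f t + f₁ t) (fun t => g t + g₁ t) where
  absCont a b := (h.absCont a b).add (h₁.absCont a b)
  deriv_ae := by filter_upwards [h.deriv_ae, h₁.deriv_ae] with t a b using a.add b

lemma mul {f g f₁ g₁ : ℝ → ℝ} (h : IsPrim f g) (h₁ : IsPrim f₁ g₁) :
    IsPrim (fun t => f t * f₁ t) (fun t => g t * f₁ t + f t * g₁ t) where
  absCont a b := (h.absCont a b).mul (h₁.absCont a b)
  deriv_ae := by filter_upwards [h.deriv_ae, h₁.deriv_ae] with t a b using a.mul b

lemma const_mul {f g : ℝ → ℝ} (c : ℝ) (h : IsPrim f g) :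
    IsPrim (fun t => c * f t) (fun t => c * g t) where
  absCont a b := (h.absCont a b).const_mul c
  deriv_ae := by filter_upwards [h.deriv_ae] with t a using a.const_mul c

lemma sub {f g f₁ g₁ : ℝ → ℝ} (h : IsPrim f g) (h₁ : IsPrim f₁ g₁) :
    IsPrim (fun t => f t - f₁ t) (fun t => g t - g₁ t) where
  absCont a b := (h.absCont a b).sub (h₁.absCont a b)
  deriv_ae := by filter_upwards [h.deriv_ae, h₁.deriv_ae] with t a b using a.sub b

lemma sum {ι : Type*} (s : Finset ι) {f g : ι → ℝ → ℝ} (h : ∀ i, IsPrim (f i) (g i)) :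
    IsPrim (fun t => ∑ i ∈ s, f i t) (fun t => ∑ i ∈ s, g i t) := by
  classical
  induction s using Finset.induction_on with
  | empty => simpa using const 0
  | insert a s ha ih => simpa [Finset.sum_insert ha] using (h a).add ih

lemma prod {ι : Type*} [DecidableEq ι] (s : Finset ι) {f g : ι → ℝ → ℝ}
    (h : ∀ i, IsPrim (f i) (g i)) :
    IsPrim (fun t => ∏ i ∈ s, f i t) (fun t => ∑ i ∈ s, (∏ j ∈ s.erase i, f j t) * g i t) where
  absCont a b := by
    induction s using Finset.induction_on with
    | empty => simpa using (const 1).absCont a b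
    | insert i s hi ih =>
      simp only [Finset.prod_insert hi]
      exact ((h i).absCont a b).mul ih
  deriv_ae := by
    have : ∀ᵐ t, ∀ i ∈ s, HasDerivAt (f i) (g i t) t := by
      rw [Filter.eventually_all_finset]
      exact fun i _ => (h i).deriv_ae
    filter_upwards [this] with t ht
    simpa using HasDerivAt.fun_finsetProd ht

/-- A 1-Lipschitz map does not enlarge increments, so the `δ` of `f` still works. This is used for
the iterated derivatives of sine. -/
lemma comp_lipschitz {f g φ φ' : ℝ → ℝ} (h : IsPrim f g) (hφ : LipschitzWith 1 φ)
    (hφ' : ∀ t, HasDerivAt φ (φ' t) t) :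
    IsPrim (fun t => φ (f t)) (fun t => φ' (f t) * g t) where
  absCont a b := by
    rw [absolutelyContinuousOnInterval_iff]
    intro ε hε
    obtain ⟨δ, hδ, H⟩ := (absolutelyContinuousOnInterval_iff _ _ _).1 (h.absCont a b) ε hε
    refine ⟨δ, hδ, fun E hE hlt => lt_of_le_of_lt ?_ (H E hE hlt)⟩
    exact Finset.sum_le_sum fun i _ => by simpa using hφ.dist_le_mul _ _
  deriv_ae := by
    filter_upwards [h.deriv_ae] with t ht
    exact (hφ' (f t)).comp t ht

end IsPrim

lemma hasDerivAt_iteratedDeriv_sin (n : ℕ) (t : ℝ) :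
    HasDerivAt (iteratedDeriv n Real.sin) (iteratedDeriv (n + 1) Real.sin t) t := by
  rw [iteratedDeriv_succ]
  exact ((Real.contDiff_sin (n := ω)).differentiable_iteratedDeriv n (by simp)).differentiableAt.hasDerivAt

lemma abs_iteratedDeriv_sin_le (n : ℕ) (t : ℝ) : |iteratedDeriv n Real.sin t| ≤ 1 :=
  Real.abs_iteratedDeriv_sin_le_one n t

lemma lipschitzWith_iteratedDeriv_sin (n : ℕ) : LipschitzWith 1 (iteratedDeriv n Real.sin) := by
  refine lipschitzWith_of_nnnorm_deriv_le
    (fun t => (hasDerivAt_iteratedDeriv_sin n t).differentiableAt) fun t => ?_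
  rw [← iteratedDeriv_succ, ← NNReal.coe_le_coe, coe_nnnorm]
  simpa using abs_iteratedDeriv_sin_le (n + 1) t

/-! ### Functions on the circle: lifts, Fourier uniqueness, weak derivatives -/

/-- `IsPrim` for the periodic lifts of functions on the circle. -/
def IsCirclePrim (f g : UnitAddCircle → ℝ) : Prop :=
  IsPrim (fun t : ℝ => f t) (fun t : ℝ => g t)

instance isProbabilityMeasure_circle :
    IsProbabilityMeasure (volume : Measure UnitAddCircle) := ⟨UnitAddCircle.measure_univ⟩

lemma haarAddCircle_eq_volume :
    (AddCircle.haarAddCircle : Measure UnitAddCircle) = volume := by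
  rw [AddCircle.volume_eq_smul_haarAddCircle]; simp

lemma integral_circle_eq (f : UnitAddCircle → ℝ) (a : ℝ) :
    ∫ x, f x = ∫ t in a..(a + 1), f (t : UnitAddCircle) :=
  (UnitAddCircle.intervalIntegral_preimage a f).symm

/-- The unit intervals `(n, n + 1]` tile the line, and the quotient map preserves measure on each of
them. -/
lemma ae_lift {p : UnitAddCircle → Prop} (h : ∀ᵐ x, p x) : ∀ᵐ t : ℝ, p (t : UnitAddCircle) := by
  have key : ∀ n : ℤ, ∀ᵐ t : ℝ ∂(volume.restrict (Set.Ioc (n : ℝ) (n + 1))),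
      p (t : UnitAddCircle) := fun n =>
    (UnitAddCircle.measurePreserving_mk (n : ℝ)).quasiMeasurePreserving.ae h
  have h2 := (ae_restrict_iUnion_iff (μ := volume) (fun n : ℤ => Set.Ioc (n : ℝ) (n + 1))
    (fun t : ℝ => p (t : UnitAddCircle))).2 key
  rwa [iUnion_Ioc_intCast, Measure.restrict_univ] at h2

lemma locallyIntegrable_lift {g : UnitAddCircle → ℝ} (hg : Integrable g) :
    LocallyIntegrable (fun t : ℝ => g t) := by
  have hper : Function.Periodic (fun t : ℝ => g t) 1 := fun t => by simp
  have h0 : IntervalIntegrable (fun t : ℝ => g t) volume 0 (0 + 1) := by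
    rw [intervalIntegrable_iff, Set.uIoc_of_le (by norm_num)]
    exact (UnitAddCircle.measurePreserving_mk 0).integrable_comp_of_integrable hg
  intro x
  refine ⟨Set.Ioo (x - 1) (x + 1), Ioo_mem_nhds (by linarith) (by linarith), ?_⟩
  have := hper.intervalIntegrable (t := 0) one_ne_zero (by simpa using h0) (x - 1) (x + 1)
  rw [intervalIntegrable_iff, Set.uIoc_of_le (by linarith)] at this
  exact this.mono_set Set.Ioo_subset_Ioc_self

lemma L2_integrable (f : CircleL2) : Integrable (f : UnitAddCircle → ℝ) :=
  (Lp.memLp f).integrable (by norm_num)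

/-- The function `cos (2πkx)` on the circle. -/
def circleCos (k : ℤ) : C(UnitAddCircle, ℝ) :=
  ⟨fun x => (fourier k x).re, Complex.continuous_re.comp (fourier k).continuous⟩

/-- The function `sin (2πkx)` on the circle. -/
def circleSin (k : ℤ) : C(UnitAddCircle, ℝ) :=
  ⟨fun x => (fourier k x).im, Complex.continuous_im.comp (fourier k).continuous⟩

lemma fourier_coe_eq (k : ℤ) (t : ℝ) :
    fourier k (t : UnitAddCircle) = Complex.exp ((2 * Real.pi * k * t : ℝ) * Complex.I) := by
  rw [fourier_coe_apply]; congr 1; push_cast; ring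

@[simp] lemma circleCos_coe (k : ℤ) (t : ℝ) :
    circleCos k (t : UnitAddCircle) = Real.cos (2 * Real.pi * k * t) := by
  change (fourier k (t : UnitAddCircle)).re = _
  rw [fourier_coe_eq, Complex.exp_ofReal_mul_I_re]

@[simp] lemma circleSin_coe (k : ℤ) (t : ℝ) :
    circleSin k (t : UnitAddCircle) = Real.sin (2 * Real.pi * k * t) := by
  change (fourier k (t : UnitAddCircle)).im = _
  rw [fourier_coe_eq, Complex.exp_ofReal_mul_I_im]

/-- After complexification the Fourier coefficients are `∫ g cos - i ∫ g sin`, and the complex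
Fourier basis is complete. -/
lemma L2_eq_zero_of_fourier (g : CircleL2) (hc : ∀ k, ∫ x, g x * circleCos k x = 0)
    (hs : ∀ k, ∫ x, g x * circleSin k x = 0) : g = 0 := by
  have hm : MemLp (fun x => (g x : ℂ)) 2 (AddCircle.haarAddCircle : Measure UnitAddCircle) := by
    rw [haarAddCircle_eq_volume]; exact (Lp.memLp g).ofReal
  have hz : hm.toLp = 0 := by
    apply fourierBasis.repr.injective
    ext i
    rw [fourierBasis_repr, map_zero, lp.coeFn_zero, Pi.zero_apply, fourierCoeff_congr_ae hm.coeFn_toLp]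
    rw [fourierCoeff, haarAddCircle_eq_volume]
    have e : ∀ x : UnitAddCircle, fourier (-i) x • (g x : ℂ)
        = ((g x * circleCos i x : ℝ) : ℂ) - ((g x * circleSin i x : ℝ) : ℂ) * Complex.I := by
      intro x
      rw [fourier_neg, smul_eq_mul]
      apply Complex.ext <;> simp [circleCos, circleSin] <;> ring
    simp_rw [e]
    have e1 : ∫ x : UnitAddCircle, ((g x * circleCos i x : ℝ) : ℂ) = 0 := by
      exact integral_ofReal.trans (congrArg Complex.ofReal (hc i))
    have e2 : ∫ x : UnitAddCircle, ((g x * circleSin i x : ℝ) : ℂ) = 0 := by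
      exact integral_ofReal.trans (congrArg Complex.ofReal (hs i))
    rw [integral_sub, integral_mul_const]
    · change (∫ x : UnitAddCircle, _) - (∫ x : UnitAddCircle, _) * Complex.I = 0
      rw [e1, e2]; simp
    · exact (integrable_L2_mul_cont g (circleCos i).continuous).ofReal
    · exact (integrable_L2_mul_cont g (circleSin i).continuous).ofReal.mul_const _
  rw [Lp.ext_iff]
  have h1 := hm.coeFn_toLp
  rw [hz] at h1
  have h2 := (Lp.coeFn_zero ℂ 2 (AddCircle.haarAddCircle : Measure UnitAddCircle)).symm.trans h1
  rw [haarAddCircle_eq_volume] at h2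
  filter_upwards [h2, Lp.coeFn_zero ℝ 2 (volume : Measure UnitAddCircle)] with x hx h0
  rw [h0]
  simpa using hx.symm

/-- Integration by parts over one period; the boundary terms cancel by periodicity. -/
lemma isWeakDeriv_of_isCirclePrim {f g : CircleL2} {F : C(UnitAddCircle, ℝ)} (hF : f =ᵐ[volume] F)
    (h : IsCirclePrim F g) : IsWeakDeriv f g := by
  intro φ φ' hφ hφ'
  have c := continuous_of_pullback hφ.continuous
  have c' := continuous_test_deriv hφ hφ'
  have hp := h.mul (IsPrim.of_contDiff (hφ.of_le (by simp)) hφ')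
  have h1 := hp.integral_eq 0 (0 + 1)
  have e1 : ∫ x, f x * φ' x = ∫ x, F x * φ' x :=
    integral_congr_ae (hF.mono fun x hx => by simp only [hx])
  have h2 := integral_circle_eq (fun x => g x * φ x + F x * φ' x) 0
  have hi : Integrable (fun x => F x * φ' x) :=
    (F.continuous.mul c').integrable_of_hasCompactSupport
      (HasCompactSupport.of_compactSpace _)
  rw [integral_add (integrable_L2_mul_cont g c) hi] at h2
  rw [h1] at h2
  simp only [zero_add, QuotientAddGroup.mk_zero, AddCircle.coe_period] at h2
  linarith [e1]

lemma isCirclePrim_of_contDiff {φ φ' : UnitAddCircle → ℝ}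
    (h : ContDiff ℝ 1 (fun t : ℝ => φ t))
    (h' : ∀ t : ℝ, HasDerivAt (fun s : ℝ => φ s) (φ' t) t) : IsCirclePrim φ φ' :=
  IsPrim.of_contDiff h h'

lemma hasDerivAt_circleCos (k : ℤ) (t : ℝ) :
    HasDerivAt (fun s : ℝ => circleCos k s) ((-(2 * Real.pi * k) • circleSin k) (t : UnitAddCircle)) t := by
  simp only [circleCos_coe, ContinuousMap.smul_apply, circleSin_coe, smul_eq_mul]
  have := ((hasDerivAt_id t).const_mul (2 * Real.pi * k)).cos
  simp only [id, mul_one] at this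
  convert this using 1; ring

lemma hasDerivAt_circleSin (k : ℤ) (t : ℝ) :
    HasDerivAt (fun s : ℝ => circleSin k s) (((2 * Real.pi * k) • circleCos k) (t : UnitAddCircle)) t := by
  simp only [circleSin_coe, ContinuousMap.smul_apply, circleCos_coe, smul_eq_mul]
  have := ((hasDerivAt_id t).const_mul (2 * Real.pi * k)).sin
  simp only [id, mul_one] at this
  convert this using 1; ring

lemma contDiff_circleCos (k : ℤ) : ContDiff ℝ ∞ (fun s : ℝ => circleCos k s) := by
  simp only [circleCos_coe]; fun_prop

lemma contDiff_circleSin (k : ℤ) : ContDiff ℝ ∞ (fun s : ℝ => circleSin k s) := by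
  simp only [circleSin_coe]; fun_prop

/-- Du Bois-Reymond: an `L²` function with mean zero and weak derivative zero vanishes. -/
lemma eq_zero_of_isWeakDeriv_zero {d : CircleL2} (h : IsWeakDeriv d 0) (hm : ∫ x, d x = 0) :
    d = 0 := by
  have h0 : ∀ ψ : UnitAddCircle → ℝ, ∫ x, (0 : CircleL2) x * ψ x = 0 := fun ψ => by
    rw [← integral_zero UnitAddCircle ℝ]
    apply integral_congr_ae
    filter_upwards [Lp.coeFn_zero ℝ 2 (volume : Measure UnitAddCircle)] with x hx
    rw [hx]; simp
  apply L2_eq_zero_of_fourier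
  · intro k
    by_cases hk : k = 0
    · subst hk; simpa [circleCos] using hm
    -- Testing against the sine isolates the cosine coefficient, up to the nonzero factor `2πk`; the
    -- case `k = 0` is the mean-zero hypothesis.
    · have := h _ _ (contDiff_circleSin k) (hasDerivAt_circleSin k)
      rw [h0] at this
      simp only [ContinuousMap.smul_apply, smul_eq_mul] at this
      simp_rw [mul_left_comm (d _)] at this
      rw [integral_const_mul] at this
      have hne : 2 * Real.pi * (k : ℝ) ≠ 0 := by
        have : (k : ℝ) ≠ 0 := by exact_mod_cast hk
        positivity
      simpa [hne] using this
  · intro k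
    by_cases hk : k = 0
    · subst hk; simp [circleSin]
    · have := h _ _ (contDiff_circleCos k) (hasDerivAt_circleCos k)
      rw [h0] at this
      simp only [ContinuousMap.smul_apply, smul_eq_mul] at this
      simp_rw [mul_left_comm (d _)] at this
      rw [integral_const_mul] at this
      have hne : -(2 * Real.pi * (k : ℝ)) ≠ 0 := by
        have : (k : ℝ) ≠ 0 := by exact_mod_cast hk
        exact neg_ne_zero.2 (by positivity)
      rw [neg_zero] at this
      exact (mul_eq_zero.1 this).resolve_left hne

/-- A mean-zero integrable function on the circle has a continuous periodic primitive. -/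
lemma exists_circle_primitive {g : UnitAddCircle → ℝ} (hg : Integrable g) (hm : ∫ x, g x = 0) :
    ∃ p : C(UnitAddCircle, ℝ), p 0 = 0 ∧ IsCirclePrim p g := by
  have hl := locallyIntegrable_lift hg
  have hp := IsPrim.of_integral hl 0
  have hper : Function.Periodic (fun t : ℝ => ∫ s in (0 : ℝ)..t, g s) 1 := by
    intro t
    have h1 := hp.integral_eq t (t + 1)
    rw [← integral_circle_eq, hm] at h1
    simp only at h1 ⊢
    linarith
  have hc : Continuous (fun t : ℝ => ∫ s in (0 : ℝ)..t, g s) :=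
    intervalIntegral.continuous_primitive (fun a b => hp.intervalIntegrable a b) 0
  refine ⟨⟨hper.lift, continuous_of_pullback (φ := hper.lift) hc⟩, ?_, ?_⟩
  · change hper.lift ((0 : ℝ) : UnitAddCircle) = 0
    rw [Function.Periodic.lift_coe]; simp
  · exact hp

/-- The constant `1` is an admissible test function. -/
lemma integral_weakD_eq_zero {f g : CircleL2} (h : IsWeakDeriv f g) : ∫ x, g x = 0 := by
  have := h (fun _ => 1) (fun _ => 0) contDiff_const (fun t => hasDerivAt_const _ _)
  simpa using this

lemma ContinuousMap.ext_ae {f g : C(UnitAddCircle, ℝ)} (h : f =ᵐ[volume] g) : f = g :=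
  ContinuousMap.coe_injective ((Continuous.ae_eq_iff_eq volume f.continuous g.continuous).1 h)

/-! ### Elements of `H¹₀` as primitives of their weak derivatives -/

namespace H10

/-- The bridge from weak to almost-everywhere derivatives. A periodic primitive of `Dv`, shifted by
the constant that gives it the mean of `v`, has the same weak derivative as `v`; the difference
vanishes by du Bois-Reymond. -/
lemma isCirclePrim (v : H10) : IsCirclePrim v.rep v.weakD := by
  obtain ⟨p, hp0, hp⟩ := exists_circle_primitive (L2_integrable v.weakD)
    (integral_weakD_eq_zero v.2.1)
  have hpw : ∀ c : ℝ, IsCirclePrim (p + ContinuousMap.const _ c : C(UnitAddCircle, ℝ)) v.weakD :=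
    fun c => IsPrim.congr (hp.add (IsPrim.const c)) (fun t => by simp) (fun t => by simp)
  set c : ℝ := ∫ x, (v.rep x - p x) with hc
  set P := ContinuousMap.toLp (E := ℝ) 2 volume ℝ (p + ContinuousMap.const _ c) with hP
  have hPae : P =ᵐ[volume] (p + ContinuousMap.const _ c : C(UnitAddCircle, ℝ)) :=
    ContinuousMap.coeFn_toLp _ _
  have h1 : IsWeakDeriv (v.1.fst + (-1 : ℝ) • P) (v.1.snd + (-1 : ℝ) • v.1.snd) :=
    v.2.1.add ((isWeakDeriv_of_isCirclePrim hPae (hpw c)).smul (-1))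
  have hae : (v.1.fst + (-1 : ℝ) • P : CircleL2) =ᵐ[volume] fun x => (v.rep x - p x) - c := by
    filter_upwards [Lp.coeFn_add v.1.fst ((-1 : ℝ) • P), Lp.coeFn_smul (-1 : ℝ) P, hPae,
      v.coe_ae_eq_rep] with x a b c d
    rw [a, Pi.add_apply, b, Pi.smul_apply, c, d]
    simp; ring
  have h2 : v.1.fst + (-1 : ℝ) • P = 0 := by
    refine eq_zero_of_isWeakDeriv_zero (by simpa using h1) ?_
    rw [integral_congr_ae hae, integral_sub _ (integrable_const c), ← hc]
    · simp
    · exact ((v.rep - p).continuous).integrable_of_hasCompactSupport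
        (HasCompactSupport.of_compactSpace _)
  have h3 : v.rep = p + ContinuousMap.const _ c := by
    apply ContinuousMap.ext_ae
    rw [h2] at hae
    filter_upwards [hae, Lp.coeFn_zero ℝ 2 (volume : Measure UnitAddCircle)] with x a b
    rw [b] at a
    simp at a ⊢
    linarith
  rw [h3]
  exact hpw c

lemma rep_coe (v : H10) (t : ℝ) : v.rep t = ∫ s in (0 : ℝ)..t, v.weakD s := by
  have := v.isCirclePrim.integral_eq 0 t
  rw [this]
  have h0 : v.rep ((0 : ℝ) : UnitAddCircle) = 0 := v.rep_zero
  rw [h0, sub_zero]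

lemma ext_rep {u v : H10} (h : u.rep = v.rep) (hD : u.weakD = v.weakD) : u = v := by
  apply Subtype.ext
  have h1 : u.1.fst = v.1.fst :=
    Lp.ext (u.coe_ae_eq_rep.trans (by rw [h]; exact v.coe_ae_eq_rep.symm))
  apply (WithLp.equiv 2 _).injective
  exact Prod.ext h1 hD

lemma weakD_injective : Function.Injective weakD := by
  intro u v h
  refine ext_rep ?_ h
  ext x
  induction x using QuotientAddGroup.induction_on with
  | H t =>
    rw [rep_coe, rep_coe, h]

/-- Both weak derivatives are almost-everywhere derivatives of the same lift. Identities in `H¹₀`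
can thus be checked pointwise on representatives. -/
lemma eq_of_rep {u v : H10} (h : ∀ x, u.rep x = v.rep x) : u = v := by
  have hr : u.rep = v.rep := ContinuousMap.ext h
  refine ext_rep hr ?_
  have h1 : IsWeakDeriv (u.1.fst + (-1 : ℝ) • v.1.fst) (u.1.snd + (-1 : ℝ) • v.1.snd) :=
    u.2.1.add (v.2.1.smul (-1))
  have h2 : u.1.fst = v.1.fst :=
    Lp.ext (u.coe_ae_eq_rep.trans (by rw [hr]; exact v.coe_ae_eq_rep.symm))
  have hu := u.isCirclePrim
  have hv := v.isCirclePrim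
  rw [hr] at hu
  apply Lp.ext
  have hae : ∀ᵐ t : ℝ, u.weakD t = v.weakD t := by
    filter_upwards [hu.deriv_ae, hv.deriv_ae] with t a b using a.unique b
  have h3 : ∀ᵐ x ∂(Measure.map (fun t : ℝ => (t : UnitAddCircle))
      (volume.restrict (Set.Ioc (0 : ℝ) (0 + 1)))), u.weakD x = v.weakD x := by
    rw [ae_map_iff (UnitAddCircle.measurePreserving_mk 0).measurable.aemeasurable]
    · exact ae_restrict_of_ae hae
    · exact measurableSet_eq_fun (Lp.stronglyMeasurable _).measurable
        (Lp.stronglyMeasurable _).measurable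
  rwa [(UnitAddCircle.measurePreserving_mk 0).map_eq] at h3

lemma exists_of_isCirclePrim (p : C(UnitAddCircle, ℝ)) (hp0 : p 0 = 0) (g : CircleL2)
    (h : IsCirclePrim p g) : ∃ u : H10, u.rep = p ∧ u.weakD = g := by
  have hP : ContinuousMap.toLp (E := ℝ) 2 volume ℝ p =ᵐ[volume] p := ContinuousMap.coeFn_toLp _ _
  refine ⟨⟨WithLp.toLp 2 (ContinuousMap.toLp (E := ℝ) 2 volume ℝ p, g),
    isWeakDeriv_of_isCirclePrim hP h, p, hP, hp0⟩, ?_, rfl⟩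
  apply ContinuousMap.ext_ae
  refine (coe_ae_eq_rep _).symm.trans hP

lemma rep_add (u v : H10) : (u + v).rep = u.rep + v.rep := by
  apply ContinuousMap.ext_ae
  filter_upwards [(u + v).coe_ae_eq_rep, u.coe_ae_eq_rep, v.coe_ae_eq_rep,
    Lp.coeFn_add u.1.fst v.1.fst] with x a b c d
  rw [← a, ContinuousMap.add_apply, ← b, ← c]
  exact d

lemma rep_smul (a : ℝ) (u : H10) : (a • u).rep = a • u.rep := by
  apply ContinuousMap.ext_ae
  filter_upwards [(a • u).coe_ae_eq_rep, u.coe_ae_eq_rep, Lp.coeFn_smul a u.1.fst] with x h b d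
  rw [← h, ContinuousMap.smul_apply, ← b]
  exact d

/-- The weak derivative as a bounded operator `H¹₀ → L²`. -/
def weakDL : H10 →L[ℝ] CircleL2 :=
  LinearMap.mkContinuous ⟨⟨weakD, fun _ _ => rfl⟩, fun _ _ => rfl⟩ 1 fun u => by
    rw [one_mul]; exact WithLp.norm_snd_le _ u.1

@[simp] lemma weakDL_apply (u : H10) : weakDL u = u.weakD := rfl

lemma norm_weakD_le (u : H10) : ‖u.weakD‖ ≤ ‖u‖ := WithLp.norm_snd_le _ u.1

end H10

/-! ### Sup-norm and norm estimates in terms of the weak derivative -/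

lemma L2_norm_sq (f : CircleL2) : ‖f‖ ^ 2 = ∫ x, f x ^ 2 := by
  rw [← real_inner_self_eq_norm_sq, L2.inner_def]
  congr 1; ext x; simp [pow_two]

lemma integral_abs_le_L2_norm (f : CircleL2) : ∫ x, |f x| ≤ ‖f‖ := by
  have h1 : ∫ x, |f x| = (eLpNorm f 1 volume).toReal := by
    rw [eLpNorm_one_eq_lintegral_enorm]
    exact integral_norm_eq_lintegral_enorm (Lp.aestronglyMeasurable f)
  rw [h1, Lp.norm_def]
  refine ENNReal.toReal_mono (Lp.eLpNorm_ne_top f) ?_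
  exact eLpNorm_le_eLpNorm_of_exponent_le (by norm_num) (Lp.aestronglyMeasurable f)

namespace H10

/-- The points `x` and `y` split the circle into two arcs. The increment is bounded by `∫ |Du|` over
either arc, and these two integrals add up to at most `‖Du‖`, so the increment is at most half of
it. -/
lemma abs_rep_sub_le (u : H10) (x y : UnitAddCircle) :
    |u.rep x - u.rep y| ≤ 1 / 2 * ‖u.weakD‖ := by
  obtain ⟨s, rfl⟩ := QuotientAddGroup.mk_surjective y
  obtain ⟨t, ht, rfl⟩ : ∃ t ∈ Set.Ico s (s + 1), ((t : ℝ) : UnitAddCircle) = x :=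
    ⟨AddCircle.equivIco 1 s x, (AddCircle.equivIco 1 s x).2,
      (AddCircle.equivIco 1 s).symm_apply_apply x⟩
  have hp := u.isCirclePrim
  have h1 : |u.rep t - u.rep s| ≤ ∫ r in s..t, |u.weakD r| := by
    have := hp.integral_eq s t
    rw [← this]
    exact intervalIntegral.abs_integral_le_integral_abs ht.1
  have h2 : |u.rep (s + 1 : ℝ) - u.rep t| ≤ ∫ r in t..(s + 1), |u.weakD r| := by
    have := hp.integral_eq t (s + 1)
    rw [← this]
    exact intervalIntegral.abs_integral_le_integral_abs ht.2.le
  have e : (((s + 1 : ℝ)) : UnitAddCircle) = s := by simp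
  rw [e, abs_sub_comm] at h2
  have h3 : (∫ r in s..t, |u.weakD r|) + ∫ r in t..(s + 1), |u.weakD r|
      = ∫ r in s..(s + 1), |u.weakD r| :=
    intervalIntegral.integral_add_adjacent_intervals (hp.intervalIntegrable _ _).abs
      (hp.intervalIntegrable _ _).abs
  have h4 := integral_abs_le_L2_norm u.weakD
  rw [integral_circle_eq _ s] at h4
  change |u.rep (t : UnitAddCircle) - u.rep (s : UnitAddCircle)| ≤ _
  linarith

lemma abs_rep_le (u : H10) (x : UnitAddCircle) : |u.rep x| ≤ 1 / 2 * ‖u.weakD‖ := by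
  simpa [u.rep_zero] using u.abs_rep_sub_le x 0

/-- The constant is `1 + (1/2)²`, from the sup bound of the representative on a space of total mass
one. -/
lemma norm_sq_le (u : H10) : ‖u‖ ^ 2 ≤ 5 / 4 * ‖u.weakD‖ ^ 2 := by
  rw [u.norm_sq, ← L2_norm_sq]
  have : ∫ x, u.rep x ^ 2 ≤ ∫ _ : UnitAddCircle, (1 / 2 * ‖u.weakD‖) ^ 2 := by
    refine integral_mono ?_ (integrable_const _) fun x => ?_
    · exact (u.rep.continuous.pow 2).integrable_of_hasCompactSupport
        (HasCompactSupport.of_compactSpace _)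
    · exact sq_le_sq' (by linarith [abs_le.1 (u.abs_rep_le x)]) (abs_le.1 (u.abs_rep_le x)).2
  simp at this
  nlinarith

/-- The continuous representative as a bounded operator `H¹₀ → C(𝕊)`. -/
def repL : H10 →L[ℝ] C(UnitAddCircle, ℝ) :=
  LinearMap.mkContinuous ⟨⟨rep, rep_add⟩, rep_smul⟩ 1 fun u => by
    rw [one_mul, ContinuousMap.norm_le _ (norm_nonneg _)]
    intro x
    change |u.rep x| ≤ _
    linarith [u.abs_rep_le x, u.norm_weakD_le, norm_nonneg u.weakD]

lemma exists_weakD_eq (g : CircleL2) (hm : ∫ x, g x = 0) : ∃ u : H10, u.weakD = g := by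
  obtain ⟨p, hp0, hp⟩ := exists_circle_primitive (L2_integrable g) hm
  obtain ⟨u, -, hu⟩ := exists_of_isCirclePrim p hp0 g hp
  exact ⟨u, hu⟩

end H10

/-! ### The primitive as a bounded operator from `L²` to `H¹₀` -/

/-- The constant function `1` in `L²`. -/
def oneL2 : CircleL2 := Lp.const 2 volume (1 : ℝ)

lemma oneL2_ae : oneL2 =ᵐ[volume] fun _ => (1 : ℝ) := Lp.coeFn_const ..

lemma inner_oneL2 (g : CircleL2) : inner ℝ oneL2 g = ∫ x, g x := by
  rw [L2.inner_def]
  apply integral_congr_ae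
  filter_upwards [oneL2_ae] with x hx
  rw [hx]; simp

lemma norm_oneL2 : ‖oneL2‖ = 1 := by
  have : ‖oneL2‖ ^ 2 = 1 := by
    rw [← real_inner_self_eq_norm_sq, inner_oneL2, integral_congr_ae oneL2_ae]; simp
  nlinarith [norm_nonneg oneL2]

/-- The orthogonal projection of `L²` onto the functions of mean zero. -/
def meanZeroL : CircleL2 →L[ℝ] CircleL2 :=
  ContinuousLinearMap.id ℝ _ - (innerSL ℝ oneL2).smulRight oneL2

lemma meanZeroL_apply (g : CircleL2) : meanZeroL g = g - (∫ x, g x) • oneL2 := by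
  simp [meanZeroL, inner_oneL2]

lemma integral_meanZeroL (g : CircleL2) : ∫ x, meanZeroL g x = 0 := by
  rw [← inner_oneL2, meanZeroL_apply, inner_sub_right, inner_smul_right, inner_oneL2,
    real_inner_self_eq_norm_sq, norm_oneL2]
  simp

namespace H10

/-- The primitive of `g - ∫ g` vanishing at `0`. -/
def prim (g : CircleL2) : H10 := (exists_weakD_eq _ (integral_meanZeroL g)).choose

lemma weakD_prim (g : CircleL2) : (prim g).weakD = meanZeroL g :=
  (exists_weakD_eq _ (integral_meanZeroL g)).choose_spec

/-- The primitive of `g - ∫ g` vanishing at `0`, as a bounded operator `L² → H¹₀`. -/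
def primL : CircleL2 →L[ℝ] H10 :=
  LinearMap.mkContinuous
    ⟨⟨prim, fun f g => by
        apply weakD_injective
        rw [← weakDL_apply (prim f + prim g), map_add]
        simp only [weakDL_apply, weakD_prim, map_add]⟩,
      fun a g => by
        apply weakD_injective
        rw [RingHom.id_apply, ← weakDL_apply (a • prim g), map_smul]
        simp only [weakDL_apply, weakD_prim, map_smul]⟩
    (5 / 4 * ‖meanZeroL‖) fun g => by
      change ‖prim g‖ ≤ _
      have h1 := (prim g).norm_sq_le
      rw [weakD_prim] at h1
      -- The square root of `5/4` is relaxed to `5/4`.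
      have h2 : ‖prim g‖ ≤ 5 / 4 * ‖meanZeroL g‖ := by
        refine (abs_le_of_sq_le_sq' (by nlinarith [norm_nonneg (meanZeroL g)]) (by positivity)).2
      calc ‖prim g‖ ≤ 5 / 4 * ‖meanZeroL g‖ := h2
        _ ≤ 5 / 4 * (‖meanZeroL‖ * ‖g‖) := by gcongr; exact meanZeroL.le_opNorm g
        _ = _ := by ring

lemma weakD_primL (g : CircleL2) : (primL g).weakD = meanZeroL g := weakD_prim g

lemma weakD_primL_of_mean_zero {g : CircleL2} (h : ∫ x, g x = 0) : (primL g).weakD = g := by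
  rw [weakD_primL, meanZeroL_apply, h]; simp

lemma primL_weakD (u : H10) : primL u.weakD = u :=
  weakD_injective (weakD_primL_of_mean_zero (integral_weakD_eq_zero u.2.1))

lemma primL_oneL2 : primL oneL2 = 0 := by
  apply weakD_injective
  rw [weakD_primL, meanZeroL_apply, ← inner_oneL2, real_inner_self_eq_norm_sq, norm_oneL2]
  simp; rfl

end H10

/-! ### Averaging over a parameter space -/

lemma exists_circle_interval {s : ℝ} (h0 : 0 ≤ s) (h1 : s ≤ 1) :
    ∃ A : Set UnitAddCircle, MeasurableSet A ∧
      ∀ f : UnitAddCircle → ℝ, ∫ x in A, f x = ∫ t in (0 : ℝ)..s, f t := by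
  refine ⟨{x | (AddCircle.measurableEquivIoc (1 : ℝ) 0 x : ℝ) ≤ s},
    measurableSet_le (measurable_subtype_coe.comp (MeasurableEquiv.measurable _)) measurable_const,
    fun f => ?_⟩
  set A : Set UnitAddCircle := {x | (AddCircle.measurableEquivIoc (1 : ℝ) 0 x : ℝ) ≤ s}
  have hA : MeasurableSet A :=
    measurableSet_le (measurable_subtype_coe.comp (MeasurableEquiv.measurable _)) measurable_const
  have hmem : ∀ t ∈ Set.Ioc (0 : ℝ) (0 + 1), ((t : UnitAddCircle) ∈ A ↔ t ≤ s) := by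
    intro t ht
    have : (AddCircle.measurableEquivIoc (1 : ℝ) 0 (t : UnitAddCircle)) = ⟨t, ht⟩ :=
      (AddCircle.equivIoc (1 : ℝ) 0).apply_symm_apply ⟨t, ht⟩
    simp only [A, Set.mem_ofPred_eq, this]
  rw [← integral_indicator hA, integral_circle_eq _ 0,
    intervalIntegral.integral_of_le (by norm_num), intervalIntegral.integral_of_le h0]
  rw [setIntegral_congr_fun (g := (Set.Ioc 0 s).indicator fun t : ℝ => f t) measurableSet_Ioc]
  · rw [setIntegral_indicator measurableSet_Ioc,
      Set.inter_eq_right.2 (Set.Ioc_subset_Ioc_right (by linarith))]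
  · intro t ht
    simp only [Set.indicator, hmem t ht, Set.mem_Ioc, ht.1, true_and]

section Average

variable {Ω : Type*} [MeasureSpace Ω] [IsProbabilityMeasure (volume : Measure Ω)]

/-- Integration over the parameter, as the adjoint of `h ↦ h ∘ snd`. -/
def averageL : Lp ℝ 2 (volume : Measure (Ω × UnitAddCircle)) →L[ℝ] CircleL2 :=
  ContinuousLinearMap.adjoint
    (Lp.compMeasurePreservingₗᵢ ℝ (Prod.snd : Ω × UnitAddCircle → UnitAddCircle)
      (measurePreserving_snd (μ := (volume : Measure Ω)))).toContinuousLinearMap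

/-- The adjoint of an isometry is a contraction. -/
lemma norm_averageL_apply_le (g : Lp ℝ 2 (volume : Measure (Ω × UnitAddCircle))) :
    ‖averageL g‖ ≤ ‖g‖ := by
  refine (ContinuousLinearMap.le_opNorm _ _).trans ?_
  refine mul_le_of_le_one_left (norm_nonneg _) ?_
  rw [averageL, LinearIsometryEquiv.norm_map]
  exact LinearIsometry.norm_toContinuousLinearMap_le _

/-- Pairing with the indicator of `A` moves the adjoint onto that indicator, whose pullback is the
indicator of the cylinder over `A`; Fubini does the rest. -/
lemma setIntegral_averageL (g : Lp ℝ 2 (volume : Measure (Ω × UnitAddCircle)))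
    {A : Set UnitAddCircle} (hA : MeasurableSet A) :
    ∫ x in A, averageL g x = ∫ w : Ω, ∫ x in A, g (w, x) := by
  have hfin : (volume : Measure UnitAddCircle) A ≠ ⊤ := measure_ne_top _ _
  rw [← L2.inner_indicatorConstLp_one (𝕜 := ℝ) hA hfin, averageL,
    ContinuousLinearMap.adjoint_inner_right]
  have e : (Lp.compMeasurePreservingₗᵢ ℝ (Prod.snd : Ω × UnitAddCircle → UnitAddCircle)
      (measurePreserving_snd (μ := (volume : Measure Ω)))).toContinuousLinearMap
        (indicatorConstLp 2 hA hfin (1 : ℝ)) =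
      indicatorConstLp 2 (hA.preimage measurable_snd) (measure_ne_top _ _) (1 : ℝ) :=
    Lp.indicatorConstLp_compMeasurePreserving hA hfin 1
      (measurePreserving_snd (μ := (volume : Measure Ω)))
  rw [e, L2.inner_indicatorConstLp_one, ← Set.univ_prod]
  have hi : Integrable g := (Lp.memLp g).integrable (by norm_num)
  refine (setIntegral_prod (μ := volume) (ν := volume) (s := Set.univ) (t := A) g
    hi.integrableOn).trans ?_
  simp

/-- If `G w` has the derivative `G' w` for every `w`, the primitive of the `w`-average of `k G'` is
the `w`-average of `k G`, normalized to vanish at `0`. -/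
lemma rep_primL_averageL {k : Ω → ℝ} {G G' : Ω × UnitAddCircle → ℝ}
    (g : Lp ℝ 2 (volume : Measure (Ω × UnitAddCircle)))
    (hg : g =ᵐ[volume] fun p => k p.1 * G' p)
    (hG : ∀ w, IsCirclePrim (fun x => G (w, x)) (fun x => G' (w, x)))
    (hi : ∀ x, Integrable (fun w => k w * G (w, x))) :
    (H10.primL (averageL g)).weakD = averageL g ∧
      ∀ x, (H10.primL (averageL g)).rep x = (∫ w, k w * G (w, x)) - ∫ w, k w * G (w, 0) := by
  have key : ∀ s : ℝ, 0 ≤ s → s ≤ 1 → ∫ t in (0 : ℝ)..s, averageL g t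
      = (∫ w, k w * G (w, s)) - ∫ w, k w * G (w, 0) := by
    intro s h0 h1
    obtain ⟨A, hA, h⟩ := exists_circle_interval h0 h1
    rw [← h, setIntegral_averageL g hA, ← integral_sub (hi _) (hi _)]
    apply integral_congr_ae
    have hg2 : ∀ᵐ w : Ω, ∀ᵐ x : UnitAddCircle, g (w, x) = k w * G' (w, x) :=
      Measure.ae_ae_of_ae_prod hg
    filter_upwards [hg2] with w hw
    rw [setIntegral_congr_ae hA (hw.mono fun x hx _ => hx), integral_const_mul, h]
    have := (hG w).integral_eq 0 s
    rw [this, ← mul_sub]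
    rfl
  -- The endpoint `s = 1` of `key` is the point `0` again, so the average already has mean zero and
  -- `primL` subtracts nothing.
  have hm : ∫ x, averageL g x = 0 := by
    rw [integral_circle_eq _ 0, zero_add, key 1 zero_le_one le_rfl, AddCircle.coe_period, sub_self]
  have hw := H10.weakD_primL_of_mean_zero hm
  refine ⟨hw, fun x => ?_⟩
  obtain ⟨t, ht, rfl⟩ : ∃ t ∈ Set.Ico (0 : ℝ) (0 + 1), ((t : ℝ) : UnitAddCircle) = x :=
    ⟨AddCircle.equivIco 1 0 x, (AddCircle.equivIco 1 0 x).2,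
      (AddCircle.equivIco 1 0).symm_apply_apply x⟩
  rw [H10.rep_coe, hw, key t ht.1 (by linarith [ht.2])]

end Average

/-! ### Smoothness of superposition operators on continuous functions -/

section Superposition

variable {X : Type*} [TopologicalSpace X] [CompactSpace X]

/-- The function `x ↦ exp (i f x)`. -/
def expI (f : C(X, ℝ)) : C(X, ℂ) :=
  ⟨fun x => Complex.exp (f x * Complex.I), by fun_prop⟩

/-- The pointwise exponential is the Banach algebra exponential of `C(X, ℂ)`, since evaluation at a
point is a continuous algebra homomorphism; the latter is analytic. Sine and cosine follow as
imaginary and real parts. -/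
lemma contDiff_expI : ContDiff ℝ ∞ (expI : C(X, ℝ) → C(X, ℂ)) := by
  have h1 : (expI : C(X, ℝ) → C(X, ℂ)) = fun f => NormedSpace.exp
      (((ContinuousLinearMap.toSpanSingleton ℝ Complex.I).compLeftContinuous ℝ X) f) := by
    funext f
    ext x
    have h2 := NormedSpace.map_exp (ContinuousMap.evalAlgHom ℂ ℂ x)
      (ContinuousEvalConst.continuous_eval_const x)
      (((ContinuousLinearMap.toSpanSingleton ℝ Complex.I).compLeftContinuous ℝ X) f)
    change _ = ContinuousMap.evalAlgHom ℂ ℂ x (NormedSpace.exp _)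
    rw [h2, ← Complex.exp_eq_exp_ℂ]
    simp [expI]
  rw [h1]
  have h3 : ContDiff ℝ ∞ (NormedSpace.exp : C(X, ℂ) → C(X, ℂ)) := by
    rw [contDiff_iff_contDiffAt]
    exact fun f => (NormedSpace.exp_analytic (𝕂 := ℝ) f).contDiffAt
  exact h3.comp ((ContinuousLinearMap.toSpanSingleton ℝ Complex.I).compLeftContinuous ℝ X).contDiff

/-- The function `x ↦ cos (f x)`. -/
def cosC (f : C(X, ℝ)) : C(X, ℝ) := ⟨fun x => Real.cos (f x), by fun_prop⟩

/-- The function `x ↦ sin (f x)`. -/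
def sinC (f : C(X, ℝ)) : C(X, ℝ) := ⟨fun x => Real.sin (f x), by fun_prop⟩

lemma contDiff_cosC : ContDiff ℝ ∞ (cosC : C(X, ℝ) → C(X, ℝ)) := by
  have : (cosC : C(X, ℝ) → C(X, ℝ)) =
      (Complex.reCLM.compLeftContinuous ℝ X) ∘ expI := by
    funext f; ext x
    exact (Complex.exp_ofReal_mul_I_re _).symm
  rw [this]
  exact (ContinuousLinearMap.contDiff _).comp contDiff_expI

lemma contDiff_sinC : ContDiff ℝ ∞ (sinC : C(X, ℝ) → C(X, ℝ)) := by
  have : (sinC : C(X, ℝ) → C(X, ℝ)) =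
      (Complex.imCLM.compLeftContinuous ℝ X) ∘ expI := by
    funext f; ext x
    exact (Complex.exp_ofReal_mul_I_im _).symm
  rw [this]
  exact (ContinuousLinearMap.contDiff _).comp contDiff_expI

end Superposition

/-! ### Shift interactions: smoothness, derivatives and bounds -/

set_option linter.unusedSectionVars false

lemma exists_mul_Lp {X : Type*} [MeasurableSpace X] {μ : Measure X} {b : X → ℝ}
    (hb : Measurable b) {C : ℝ} (hC : ∀ p, |b p| ≤ C) (f : Lp ℝ 2 μ) :
    ∃ g : Lp ℝ 2 μ, (g =ᵐ[μ] fun p => b p * f p) ∧ ‖g‖ ≤ C * ‖f‖ := by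
  have hm : MemLp (fun p => b p * f p) 2 μ :=
    (Lp.memLp f).of_le_mul (c := C) (hb.aestronglyMeasurable.mul (Lp.aestronglyMeasurable f))
      (Filter.Eventually.of_forall fun p => by
        rw [norm_mul]; exact mul_le_mul_of_nonneg_right (hC p) (norm_nonneg _))
  refine ⟨hm.toLp, hm.coeFn_toLp, Lp.norm_le_mul_norm_of_ae_le_mul ?_⟩
  filter_upwards [hm.coeFn_toLp] with p hp
  rw [hp, norm_mul]
  exact mul_le_mul_of_nonneg_right (hC p) (norm_nonneg _)

/-- An interaction `∫ k(w) sin (θ(w) + ∑ⱼ cⱼ v(x + τⱼ(w))) dw` with bounded kernel `k`. -/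
structure ShiftInteraction (Ω : Type) [TopologicalSpace Ω] [MeasurableSpace Ω] where
  /-- number of shifts -/
  arity : ℕ
  /-- the coefficients `cⱼ` -/
  coef : Fin arity → ℝ
  /-- the shifts `τⱼ` -/
  shift : Fin arity → C(Ω, UnitAddCircle)
  /-- the kernel `k` -/
  kernel : Ω → ℝ
  /-- the phase `θ` -/
  phase : Ω → ℝ
  measurable_kernel : Measurable kernel
  measurable_phase : Measurable phase
  abs_kernel_le : ∀ w, |kernel w| ≤ 1

lemma IsCirclePrim.translate {f g : UnitAddCircle → ℝ} (h : IsCirclePrim f g) (τ : UnitAddCircle) :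
    IsCirclePrim (fun x => f (x + τ)) (fun x => g (x + τ)) := by
  obtain ⟨t, rfl⟩ := QuotientAddGroup.mk_surjective τ
  exact h.comp_add t

namespace ShiftInteraction

variable {Ω : Type} [TopologicalSpace Ω]

section Measurable
variable [MeasurableSpace Ω] (S : ShiftInteraction Ω)

/-- The combination `∑ⱼ cⱼ f(x + τⱼ(w))`. -/
def comb (f : UnitAddCircle → ℝ) (p : Ω × UnitAddCircle) : ℝ :=
  ∑ j, S.coef j * f (p.2 + S.shift j p.1)

lemma isCirclePrim_comb {f g : UnitAddCircle → ℝ} (h : IsCirclePrim f g) (w : Ω) :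
    IsCirclePrim (fun x => S.comb f (w, x)) (fun x => S.comb g (w, x)) :=
  IsPrim.sum _ fun j => IsPrim.const_mul _ (h.translate (S.shift j w))

end Measurable

section Operators

variable [CompactSpace Ω] [SecondCountableTopology Ω] [MeasureSpace Ω] [BorelSpace Ω]
  [IsProbabilityMeasure (volume : Measure Ω)] (S : ShiftInteraction Ω)

/-- For fixed `w` the map is a rotation, so the skew product with the identity of `Ω` preserves the
product measure. This makes shifted `L²` classes well defined. -/
lemma measurePreserving_shift (j : Fin S.arity) :
    MeasurePreserving (fun p : Ω × UnitAddCircle => p.2 + S.shift j p.1) volume volume := by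
  have h : MeasurePreserving (fun p : Ω × UnitAddCircle => (p.1, p.2 + S.shift j p.1))
      (volume.prod volume) (volume.prod volume) :=
    (MeasurePreserving.id (volume : Measure Ω)).skew_product
      (g := fun w x => x + S.shift j w)
      (by
        have : Continuous fun p : Ω × UnitAddCircle => p.2 + S.shift j p.1 := by fun_prop
        exact this.measurable)
      (Filter.Eventually.of_forall fun w => map_add_right_eq_self _ _)
  exact measurePreserving_snd.comp h

/-- `comb` on continuous functions. -/
def combC : C(UnitAddCircle, ℝ) →L[ℝ] C(Ω × UnitAddCircle, ℝ) :=
  ∑ j, S.coef j • (⟨(ContinuousMap.compRightAlgHom ℝ ℝ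
    (⟨fun p => p.2 + S.shift j p.1, by fun_prop⟩ : C(Ω × UnitAddCircle, UnitAddCircle))).toLinearMap,
    ContinuousMap.compRightAlgHom_continuous _ _ _⟩ : C(UnitAddCircle, ℝ) →L[ℝ] C(Ω × UnitAddCircle, ℝ))

@[simp] lemma combC_apply (f : C(UnitAddCircle, ℝ)) (p : Ω × UnitAddCircle) :
    S.combC f p = S.comb f p := by
  simp only [combC, comb, sum_apply, ContinuousMap.sum_apply]
  rfl

lemma continuous_comb (f : C(UnitAddCircle, ℝ)) : Continuous (S.comb f) := by
  have := (S.combC f).continuous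
  rwa [show (S.combC f : Ω × UnitAddCircle → ℝ) = S.comb f from funext (S.combC_apply f)] at this

/-- `comb` on square-integrable functions. -/
def combL : CircleL2 →L[ℝ] Lp ℝ 2 (volume : Measure (Ω × UnitAddCircle)) :=
  ∑ j, S.coef j •
    (Lp.compMeasurePreservingₗᵢ ℝ _ (S.measurePreserving_shift j)).toContinuousLinearMap

lemma coeFn_combL (f : CircleL2) : S.combL f =ᵐ[volume] S.comb f := by
  have e : S.combL f = ∑ j, S.coef j • Lp.compMeasurePreserving _ (S.measurePreserving_shift j) f := by
    simp [combL, Lp.compMeasurePreservingₗᵢ, Lp.compMeasurePreservingₗ]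
  rw [e]
  have h2 : ∀ᵐ p : Ω × UnitAddCircle, ∀ j : Fin S.arity,
      (S.coef j • Lp.compMeasurePreserving _ (S.measurePreserving_shift j) f :
        Lp ℝ 2 (volume : Measure (Ω × UnitAddCircle))) p = S.coef j * f (p.2 + S.shift j p.1) := by
    rw [ae_all_iff]
    intro j
    filter_upwards [Lp.coeFn_smul (S.coef j)
      (Lp.compMeasurePreserving _ (S.measurePreserving_shift j) f),
      Lp.coeFn_compMeasurePreserving f (S.measurePreserving_shift j)] with p h1 h2
    rw [h1, Pi.smul_apply, h2]; rfl
  filter_upwards [Lp.coeFn_finsetSum Finset.univ fun j =>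
    (S.coef j • Lp.compMeasurePreserving _ (S.measurePreserving_shift j) f :
        Lp ℝ 2 (volume : Measure (Ω × UnitAddCircle))), h2] with p h1 h2
  rw [h1, Finset.sum_apply, comb]
  exact Finset.sum_congr rfl fun j _ => h2 j

lemma norm_combL_le (f : CircleL2) : ‖S.combL f‖ ≤ (∑ j, |S.coef j|) * ‖f‖ := by
  have e : S.combL f = ∑ j, S.coef j • Lp.compMeasurePreserving _ (S.measurePreserving_shift j) f := by
    simp [combL, Lp.compMeasurePreservingₗᵢ, Lp.compMeasurePreservingₗ]
  rw [e, Finset.sum_mul]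
  refine (norm_sum_le _ _).trans (Finset.sum_le_sum fun j _ => ?_)
  rw [norm_smul, Lp.norm_compMeasurePreserving, Real.norm_eq_abs]

lemma abs_comb_rep_le (u : H10) (p : Ω × UnitAddCircle) :
    |S.comb u.rep p| ≤ (∑ j, |S.coef j|) * ‖u.weakD‖ := by
  rw [comb, Finset.sum_mul]
  refine (Finset.abs_sum_le_sum_abs _ _).trans (Finset.sum_le_sum fun j _ => ?_)
  rw [abs_mul]
  refine mul_le_mul_of_nonneg_left ?_ (abs_nonneg _)
  linarith [u.abs_rep_le (p.2 + S.shift j p.1), norm_nonneg u.weakD]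

/-- Multiplication `L^∞ × L² → L²`. -/
def mulLp : Lp ℝ ⊤ (volume : Measure (Ω × UnitAddCircle)) →L[ℝ]
    Lp ℝ 2 (volume : Measure (Ω × UnitAddCircle)) →L[ℝ]
    Lp ℝ 2 (volume : Measure (Ω × UnitAddCircle)) :=
  (ContinuousLinearMap.mul ℝ ℝ).holderL volume ⊤ 2 2

lemma coeFn_mulLp (b : Lp ℝ ⊤ (volume : Measure (Ω × UnitAddCircle)))
    (f : Lp ℝ 2 (volume : Measure (Ω × UnitAddCircle))) :
    mulLp b f =ᵐ[volume] fun p => b p * f p :=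
  (ContinuousLinearMap.mul ℝ ℝ).coeFn_holder b f

/-- `k cos θ` as an element of `L^∞`. -/
def kernelCos : Lp ℝ ⊤ (volume : Measure (Ω × UnitAddCircle)) :=
  (memLp_top_of_bound (f := fun p : Ω × UnitAddCircle => S.kernel p.1 * Real.cos (S.phase p.1))
    ((S.measurable_kernel.mul (Real.measurable_cos.comp S.measurable_phase)).comp
      measurable_fst).aestronglyMeasurable 1 (Filter.Eventually.of_forall fun p => by
        rw [norm_mul]
        exact mul_le_one₀ (S.abs_kernel_le _) (norm_nonneg _) (Real.abs_cos_le_one _))).toLp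

/-- `k sin θ` as an element of `L^∞`. -/
def kernelSin : Lp ℝ ⊤ (volume : Measure (Ω × UnitAddCircle)) :=
  (memLp_top_of_bound (f := fun p : Ω × UnitAddCircle => S.kernel p.1 * Real.sin (S.phase p.1))
    ((S.measurable_kernel.mul (Real.measurable_sin.comp S.measurable_phase)).comp
      measurable_fst).aestronglyMeasurable 1 (Filter.Eventually.of_forall fun p => by
        rw [norm_mul]
        exact mul_le_one₀ (S.abs_kernel_le _) (norm_nonneg _) (Real.abs_sin_le_one _))).toLp

lemma coeFn_kernelCos : S.kernelCos =ᵐ[volume] fun p : Ω × UnitAddCircle =>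
    S.kernel p.1 * Real.cos (S.phase p.1) := MemLp.coeFn_toLp _

lemma coeFn_kernelSin : S.kernelSin =ᵐ[volume] fun p : Ω × UnitAddCircle =>
    S.kernel p.1 * Real.sin (S.phase p.1) := MemLp.coeFn_toLp _

/-- The integrand of the derivative of the interaction. -/
def integrandD (v : H10) : Lp ℝ 2 (volume : Measure (Ω × UnitAddCircle)) :=
  mulLp (ContinuousMap.toLp ⊤ volume ℝ (cosC (S.combC v.rep))) (mulLp S.kernelCos (S.combL v.weakD))
  - mulLp (ContinuousMap.toLp ⊤ volume ℝ (sinC (S.combC v.rep)))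
      (mulLp S.kernelSin (S.combL v.weakD))

lemma coeFn_integrandD (v : H10) : S.integrandD v =ᵐ[volume] fun p => S.kernel p.1 *
    (Real.cos (S.phase p.1 + S.comb v.rep p) * S.comb v.weakD p) := by
  filter_upwards [Lp.coeFn_sub (mulLp (ContinuousMap.toLp ⊤ volume ℝ (cosC (S.combC v.rep)))
      (mulLp S.kernelCos (S.combL v.weakD)))
      (mulLp (ContinuousMap.toLp ⊤ volume ℝ (sinC (S.combC v.rep)))
      (mulLp S.kernelSin (S.combL v.weakD))),
    coeFn_mulLp (ContinuousMap.toLp ⊤ volume ℝ (cosC (S.combC v.rep)))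
      (mulLp S.kernelCos (S.combL v.weakD)),
    coeFn_mulLp (ContinuousMap.toLp ⊤ volume ℝ (sinC (S.combC v.rep)))
      (mulLp S.kernelSin (S.combL v.weakD)),
    coeFn_mulLp S.kernelCos (S.combL v.weakD), coeFn_mulLp S.kernelSin (S.combL v.weakD),
    S.coeFn_kernelCos, S.coeFn_kernelSin,
    ContinuousMap.coeFn_toLp (p := ⊤) (𝕜 := ℝ) (volume : Measure (Ω × UnitAddCircle))
      (cosC (S.combC v.rep)),
    ContinuousMap.coeFn_toLp (p := ⊤) (𝕜 := ℝ) (volume : Measure (Ω × UnitAddCircle))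
      (sinC (S.combC v.rep)), S.coeFn_combL v.weakD] with p h1 h2 h3 h4 h5 h6 h7 h8 h9 h10
  rw [integrandD, h1, Pi.sub_apply, h2, h3, h4, h5, h6, h7, h8, h9, h10, Real.cos_add]
  change Real.cos (S.combC v.rep p) * _ - Real.sin (S.combC v.rep p) * _ = _
  rw [combC_apply]
  ring

/-- The addition formula in `integrandD` puts the merely measurable phase into fixed `L^∞` factors
and leaves sine and cosine of the continuous function `combC v.rep`, where superposition is smooth.
The remaining operations are bounded linear or bilinear. -/
lemma contDiff_integrandD : ContDiff ℝ ∞ S.integrandD := by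
  have hr : ContDiff ℝ ∞ fun v : H10 => S.combC v.rep :=
    (S.combC.comp H10.repL).contDiff
  have hd : ContDiff ℝ ∞ fun v : H10 => S.combL v.weakD :=
    (S.combL.comp H10.weakDL).contDiff
  have hc := (mulLp.comp (ContinuousMap.toLp ⊤ (volume : Measure (Ω × UnitAddCircle)) ℝ)).contDiff
    (n := ∞) |>.comp (contDiff_cosC.comp hr)
  have hs := (mulLp.comp (ContinuousMap.toLp ⊤ (volume : Measure (Ω × UnitAddCircle)) ℝ)).contDiff
    (n := ∞) |>.comp (contDiff_sinC.comp hr)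
  exact (hc.clm_apply ((mulLp S.kernelCos).contDiff.comp hd)).sub
    (hs.clm_apply ((mulLp S.kernelSin).contDiff.comp hd))

/-- The interaction as an operator on `H¹₀`. -/
def op (v : H10) : H10 := H10.primL (averageL (S.integrandD v))

lemma contDiff_op : ContDiff ℝ ∞ S.op :=
  (H10.primL.comp averageL).contDiff.comp S.contDiff_integrandD

/-- The integrand of the `n`-th derivative of the interaction. -/
def integrand {n : ℕ} (v : H10) (η : Fin n → H10) (p : Ω × UnitAddCircle) : ℝ :=
  (∏ i, S.comb (η i).rep p) * iteratedDeriv n Real.sin (S.phase p.1 + S.comb v.rep p)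

/-- The `n`-th derivative of the interaction before normalization at `0`. -/
def form {n : ℕ} (v : H10) (η : Fin n → H10) (x : UnitAddCircle) : ℝ :=
  ∫ w, S.kernel w * S.integrand v η (w, x)

lemma measurable_integrand {n : ℕ} (v : H10) (η : Fin n → H10) : Measurable (S.integrand v η) := by
  refine Measurable.mul (Finset.measurable_fun_prod _ fun i _ =>
    (S.continuous_comb _).measurable) ?_
  exact ((lipschitzWith_iteratedDeriv_sin n).continuous.measurable).comp
    ((S.measurable_phase.comp measurable_fst).add (S.continuous_comb _).measurable)

lemma abs_integrand_le {n : ℕ} (v : H10) (η : Fin n → H10) (p : Ω × UnitAddCircle) :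
    |S.integrand v η p| ≤ ∏ i, (∑ j, |S.coef j|) * ‖(η i).weakD‖ := by
  rw [integrand, abs_mul, Finset.abs_prod]
  refine (mul_le_of_le_one_right (Finset.prod_nonneg fun _ _ => abs_nonneg _)
    (abs_iteratedDeriv_sin_le _ _)).trans ?_
  exact Finset.prod_le_prod (fun _ _ => abs_nonneg _) fun i _ => S.abs_comb_rep_le _ _

lemma integrable_of_bound {h : Ω → ℝ} (hm : Measurable h) {C : ℝ} (hC : ∀ w, |h w| ≤ C) :
    Integrable h :=
  Integrable.of_bound hm.aestronglyMeasurable C (Filter.Eventually.of_forall hC)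

lemma measurable_kernel_integrand {n : ℕ} (v : H10) (η : Fin n → H10) (x : UnitAddCircle) :
    Measurable fun w => S.kernel w * S.integrand v η (w, x) :=
  S.measurable_kernel.mul ((S.measurable_integrand v η).comp (measurable_id.prodMk measurable_const))

lemma abs_kernel_integrand_le {n : ℕ} (v : H10) (η : Fin n → H10) (x : UnitAddCircle) (w : Ω) :
    |S.kernel w * S.integrand v η (w, x)| ≤ ∏ i, (∑ j, |S.coef j|) * ‖(η i).weakD‖ := by
  rw [abs_mul]
  exact (mul_le_of_le_one_left (abs_nonneg _) (S.abs_kernel_le _)).trans (S.abs_integrand_le _ _ _)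

lemma integrable_kernel_integrand {n : ℕ} (v : H10) (η : Fin n → H10) (x : UnitAddCircle) :
    Integrable fun w => S.kernel w * S.integrand v η (w, x) :=
  integrable_of_bound (S.measurable_kernel_integrand v η x) (S.abs_kernel_integrand_le v η x)

/-- The class `integrandD v` is the `x`-derivative of `k sin(θ + comb v)`. The empty family `η`
presents the operator as the case `n = 0` of `form`, the base of the later induction. -/
lemma rep_op (v : H10) (η : Fin 0 → H10) (x : UnitAddCircle) :
    (S.op v).rep x = S.form v η x - S.form v η 0 := by
  refine (rep_primL_averageL (k := S.kernel) (G := S.integrand v η) _ (S.coeFn_integrandD v) ?_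
    (S.integrable_kernel_integrand v η)).2 x
  intro w
  have h := ((IsPrim.const (S.phase w)).add (S.isCirclePrim_comb v.isCirclePrim w)).comp_lipschitz
    (lipschitzWith_iteratedDeriv_sin 0) (hasDerivAt_iteratedDeriv_sin 0)
  refine h.congr (fun t => ?_) (fun t => ?_)
  · simp [integrand]
  · simp [iteratedDeriv_one]

lemma comb_add_smul (v h : H10) (t : ℝ) (p : Ω × UnitAddCircle) :
    S.comb (v + t • h).rep p = S.comb v.rep p + t * S.comb h.rep p := by
  simp only [comb, H10.rep_add, H10.rep_smul, ContinuousMap.add_apply, ContinuousMap.smul_apply,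
    smul_eq_mul, Finset.mul_sum, ← Finset.sum_add_distrib]
  exact Finset.sum_congr rfl fun j _ => by ring

/-- One directional derivative brings down a factor `comb (η 0)` and raises the order of the sine
derivative, which is exactly the integrand with one more argument. Domination by a constant suffices
on a probability space. -/
lemma hasDerivAt_form {n : ℕ} (v : H10) (η : Fin (n + 1) → H10) (x : UnitAddCircle) :
    HasDerivAt (fun t : ℝ => S.form (v + t • η 0) (Fin.tail η) x) (S.form v η x) 0 := by
  have key : ∀ w : Ω, ∀ t : ℝ, HasDerivAt
      (fun t : ℝ => S.kernel w * S.integrand (v + t • η 0) (Fin.tail η) (w, x))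
      (S.kernel w * S.integrand (v + t • η 0) η (w, x)) t := by
    intro w t
    have h1 : HasDerivAt (fun t : ℝ => S.phase w + S.comb (v + t • η 0).rep (w, x))
        (S.comb (η 0).rep (w, x)) t := by
      simp only [comb_add_smul]
      simpa using (((hasDerivAt_id t).mul_const (S.comb (η 0).rep (w, x))).const_add
        (S.comb v.rep (w, x))).const_add (S.phase w)
    have h2 := ((hasDerivAt_iteratedDeriv_sin n _).comp t h1).const_mul
      (∏ i, S.comb (Fin.tail η i).rep (w, x))
    refine ((h2.const_mul (S.kernel w)).congr_deriv ?_).congr_of_eventuallyEq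
      (Filter.Eventually.of_forall fun t => rfl)
    simp only [integrand, Fin.prod_univ_succ, Fin.tail]
    ring
  have := hasDerivAt_integral_of_dominated_loc_of_deriv_le
    (μ := (volume : Measure Ω)) (x₀ := (0 : ℝ)) (s := Set.univ)
    (F := fun t w => S.kernel w * S.integrand (v + t • η 0) (Fin.tail η) (w, x))
    (F' := fun t w => S.kernel w * S.integrand (v + t • η 0) η (w, x))
    (bound := fun _ => ∏ i, (∑ j, |S.coef j|) * ‖(η i).weakD‖) Filter.univ_mem
    (Filter.Eventually.of_forall fun t =>
      (S.measurable_kernel_integrand _ _ x).aestronglyMeasurable)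
    (S.integrable_kernel_integrand _ _ x)
    (S.measurable_kernel_integrand _ _ x).aestronglyMeasurable
    (Filter.Eventually.of_forall fun w t _ => S.abs_kernel_integrand_le _ _ x w)
    (integrable_const _)
    (Filter.Eventually.of_forall fun w t _ => key w t)
  simpa [form] using this.2

/-- Since `op` is already smooth and evaluation at `x` is continuous linear, the next derivative is
determined by the scalar derivative of the evaluated previous one along a line, and
`hasDerivAt_form` computes it. -/
lemma rep_iteratedFDeriv_op {n : ℕ} (v : H10) (η : Fin n → H10) (x : UnitAddCircle) :
    (iteratedFDeriv ℝ n S.op v η).rep x = S.form v η x - S.form v η 0 := by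
  induction n generalizing v with
  | zero => rw [iteratedFDeriv_zero_apply]; exact S.rep_op v η x
  | succ n ih =>
    rw [iteratedFDeriv_succ_apply_left]
    let ev : H10 →L[ℝ] ℝ := (ContinuousMap.evalCLM ℝ x).comp H10.repL
    have hd : HasFDerivAt (iteratedFDeriv ℝ n S.op) (fderiv ℝ (iteratedFDeriv ℝ n S.op) v)
        (v + (0 : ℝ) • η 0) := by
      rw [zero_smul, add_zero]
      exact ((S.contDiff_op.differentiable_iteratedFDeriv (m := n)
        (by exact_mod_cast WithTop.coe_lt_coe.2 (ENat.natCast_lt_top n))) v).hasFDerivAt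
    have hl : HasDerivAt (fun t : ℝ => v + t • η 0) (η 0) 0 := by
      simpa using ((hasDerivAt_id (0 : ℝ)).smul_const (η 0)).const_add v
    have h1 := (ev.hasFDerivAt.comp _
      (hd.continuousMultilinear_apply_const (Fin.tail η))).comp_hasDerivAt (0 : ℝ) hl
    have h2 := (S.hasDerivAt_form v η x).sub (S.hasDerivAt_form v η 0)
    refine h1.unique (h2.congr_of_eventuallyEq (Filter.Eventually.of_forall fun t => ?_))
    exact ih (v + t • η 0) (Fin.tail η)

lemma isCirclePrim_integrand {n : ℕ} (v : H10) (η : Fin n → H10) (w : Ω) :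
    IsCirclePrim (fun x => S.integrand v η (w, x)) (fun x =>
      (∑ i, (∏ j ∈ Finset.univ.erase i, S.comb (η j).rep (w, x)) * S.comb (η i).weakD (w, x)) *
        iteratedDeriv n Real.sin (S.phase w + S.comb v.rep (w, x)) +
      (∏ i, S.comb (η i).rep (w, x)) *
        (iteratedDeriv (n + 1) Real.sin (S.phase w + S.comb v.rep (w, x)) *
          S.comb v.weakD (w, x))) := by
  have h1 := ((IsPrim.const (S.phase w)).add (S.isCirclePrim_comb v.isCirclePrim w)).comp_lipschitz
    (lipschitzWith_iteratedDeriv_sin n) (hasDerivAt_iteratedDeriv_sin n)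
  have h2 := IsPrim.prod Finset.univ fun i => S.isCirclePrim_comb (η i).isCirclePrim w
  exact (h2.mul h1).congr (fun t => rfl) (fun t => by simp)

/-- Bound of the weak derivative of the `n`-th derivative. -/
lemma norm_weakD_iteratedFDeriv_le {a s : ℝ} (ha0 : 0 ≤ a)
    (ha : ∀ (u : H10) p, |S.comb u.rep p| ≤ a * ‖u.weakD‖)
    (hs : ∀ u : H10, ‖S.combL u.weakD‖ ≤ s * ‖u.weakD‖)
    {n : ℕ} (v : H10) (η : Fin n → H10) :
    ‖(iteratedFDeriv ℝ n S.op v η).weakD‖ ≤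
      s * (n * a ^ (n - 1) + a ^ n * ‖v.weakD‖) * ∏ i, ‖(η i).weakD‖ := by
  have hmsin : ∀ m : ℕ, Measurable fun p : Ω × UnitAddCircle =>
      iteratedDeriv m Real.sin (S.phase p.1 + S.comb v.rep p) := fun m =>
    ((lipschitzWith_iteratedDeriv_sin m).continuous.measurable).comp
      ((S.measurable_phase.comp measurable_fst).add (S.continuous_comb _).measurable)
  have hmprod : ∀ t : Finset (Fin n), Measurable fun p : Ω × UnitAddCircle =>
      ∏ j ∈ t, S.comb (η j).rep p := fun t =>
    Finset.measurable_fun_prod _ fun i _ => (S.continuous_comb _).measurable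
  -- Every term of the product rule has a single `L²` factor, `comb (D(η i))` or `comb (Dv)`,
  -- estimated with `s`; the undifferentiated factors are bounded in sup norm, each with `a`.
  have hbd : ∀ (t : Finset (Fin n)) (m : ℕ) (p : Ω × UnitAddCircle),
      |S.kernel p.1 * ((∏ j ∈ t, S.comb (η j).rep p) *
        iteratedDeriv m Real.sin (S.phase p.1 + S.comb v.rep p))| ≤
        a ^ t.card * ∏ j ∈ t, ‖(η j).weakD‖ := by
    intro t m p
    rw [abs_mul, abs_mul, Finset.abs_prod, ← Finset.prod_const, ← Finset.prod_mul_distrib]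
    refine (mul_le_of_le_one_left (by positivity) (S.abs_kernel_le _)).trans ?_
    refine (mul_le_of_le_one_right (Finset.prod_nonneg fun _ _ => abs_nonneg _)
      (abs_iteratedDeriv_sin_le _ _)).trans ?_
    exact Finset.prod_le_prod (fun _ _ => abs_nonneg _) fun i _ => ha _ _
  have hex := fun (t : Finset (Fin n)) (m : ℕ) (f : Lp ℝ 2 (volume : Measure (Ω × UnitAddCircle))) =>
    exists_mul_Lp ((S.measurable_kernel.comp measurable_fst).mul ((hmprod t).mul (hmsin m)))
      (hbd t m) f
  choose g hg hgn using hex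
  set tot := (∑ i, g (Finset.univ.erase i) n (S.combL (η i).weakD)) +
    g Finset.univ (n + 1) (S.combL v.weakD) with htot
  have hae : tot =ᵐ[volume] fun p : Ω × UnitAddCircle => S.kernel p.1 *
     ((∑ i, (∏ j ∈ Finset.univ.erase i, S.comb (η j).rep p) * S.comb (η i).weakD p) *
        iteratedDeriv n Real.sin (S.phase p.1 + S.comb v.rep p) +
      (∏ i, S.comb (η i).rep p) *
        (iteratedDeriv (n + 1) Real.sin (S.phase p.1 + S.comb v.rep p) *
          S.comb v.weakD p)) := by
    have h1 : ∀ᵐ p : Ω × UnitAddCircle, ∀ i : Fin n,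
        g (Finset.univ.erase i) n (S.combL (η i).weakD) p =
        S.kernel p.1 * ((∏ j ∈ Finset.univ.erase i, S.comb (η j).rep p) *
        iteratedDeriv n Real.sin (S.phase p.1 + S.comb v.rep p)) * S.comb (η i).weakD p := by
      rw [ae_all_iff]
      intro i
      filter_upwards [hg (Finset.univ.erase i) n (S.combL (η i).weakD),
        S.coeFn_combL (η i).weakD] with p h1 h2
      rw [h1, h2]; rfl
    filter_upwards [Lp.coeFn_add (∑ i, g (Finset.univ.erase i) n (S.combL (η i).weakD))
      (g Finset.univ (n + 1) (S.combL v.weakD)), Lp.coeFn_finsetSum Finset.univ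
      (fun i => g (Finset.univ.erase i) n (S.combL (η i).weakD)), h1,
      hg Finset.univ (n + 1) (S.combL v.weakD), S.coeFn_combL v.weakD] with p h2 h3 h4 h5 h6
    rw [htot, h2, Pi.add_apply, h3, h5, h6, Finset.sum_apply, mul_add, Finset.sum_mul,
      Finset.mul_sum]
    congr 1
    · exact Finset.sum_congr rfl fun i _ => by rw [h4 i]; ring
    · simp only [Pi.mul_apply, Function.comp]; ring
  obtain ⟨hw, hr⟩ := rep_primL_averageL (k := S.kernel) (G := S.integrand v η)
    (G' := fun p => (∑ i, (∏ j ∈ Finset.univ.erase i, S.comb (η j).rep p) * S.comb (η i).weakD p) *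
        iteratedDeriv n Real.sin (S.phase p.1 + S.comb v.rep p) +
      (∏ i, S.comb (η i).rep p) *
        (iteratedDeriv (n + 1) Real.sin (S.phase p.1 + S.comb v.rep p) *
          S.comb v.weakD p)) tot hae (S.isCirclePrim_integrand v η)
          (S.integrable_kernel_integrand v η)
  -- The derivative and the primitive of the averaged product-rule terms have the same
  -- representative, so the weak derivative is `averageL tot`.
  have he : iteratedFDeriv ℝ n S.op v η = H10.primL (averageL tot) :=
    H10.eq_of_rep fun x => by rw [rep_iteratedFDeriv_op, hr]; rfl
  rw [he, hw]
  refine (norm_averageL_apply_le _).trans ((norm_add_le _ _).trans ?_)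
  have hterm : ∀ i : Fin n, ‖g (Finset.univ.erase i) n (S.combL (η i).weakD)‖ ≤
      s * a ^ (n - 1) * ∏ i, ‖(η i).weakD‖ := by
    intro i
    refine (hgn _ _ _).trans ?_
    -- Here `n ≥ 1`, as an index `i` exists; for `n = 0` the truncated exponent `n - 1` in the bound
    -- is multiplied by `0`.
    rw [Finset.card_erase_of_mem (Finset.mem_univ i), Finset.card_univ, Fintype.card_fin,
      ← Finset.mul_prod_erase _ _ (Finset.mem_univ i)]
    calc _ ≤ a ^ (n - 1) * (∏ j ∈ Finset.univ.erase i, ‖(η j).weakD‖) * (s * ‖(η i).weakD‖) := by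
          gcongr; exact hs _
      _ = _ := by ring
  have hlast : ‖g Finset.univ (n + 1) (S.combL v.weakD)‖ ≤
      a ^ n * (∏ i, ‖(η i).weakD‖) * (s * ‖v.weakD‖) := by
    refine (hgn _ _ _).trans ?_
    rw [Finset.card_univ, Fintype.card_fin]
    gcongr; exact hs _
  calc _ ≤ (∑ _i : Fin n, s * a ^ (n - 1) * ∏ i, ‖(η i).weakD‖) +
        a ^ n * (∏ i, ‖(η i).weakD‖) * (s * ‖v.weakD‖) :=
        add_le_add ((norm_sum_le _ _).trans (Finset.sum_le_sum fun i _ => hterm i)) hlast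
    _ = _ := by simp; ring

end Operators

end ShiftInteraction

/-! ### Twisted states modulo `2π` and the three concrete interactions -/

lemma iteratedDeriv_sin_eq_of_angle_eq (n : ℕ) {a b : ℝ} (h : (a : Real.Angle) = b) :
    iteratedDeriv n Real.sin a = iteratedDeriv n Real.sin b := by
  obtain ⟨k, hk⟩ := Real.Angle.angle_eq_iff_two_pi_dvd_sub.1 h
  have h1 := congrFun (iteratedDeriv_comp_add_const n Real.sin (k * (2 * Real.pi))) b
  have h2 : (fun z => Real.sin (z + k * (2 * Real.pi))) = Real.sin :=
    funext fun z => Real.sin_add_int_mul_two_pi z k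
  rw [h2] at h1
  rw [h1]
  congr 1
  linarith

/-- The representative of `t` in `[0, 1)` differs from `t` by an integer, and `q` is an integer, so
the jump of the twisted state is invisible modulo `2π`. -/
lemma twistedState_angle_coe (q : ℕ) (t : ℝ) :
    (twistedState q (t : UnitAddCircle) : Real.Angle) = ((2 * Real.pi * q * t : ℝ) : Real.Angle) := by
  have h : (((AddCircle.equivIco 1 0 (t : UnitAddCircle) : ℝ) - t : ℝ) : UnitAddCircle) = 0 := by
    rw [AddCircle.coe_sub, sub_eq_zero]
    exact (AddCircle.equivIco 1 0).symm_apply_apply (t : UnitAddCircle)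
  rw [Real.Angle.angle_eq_iff_two_pi_dvd_sub]
  obtain ⟨k, hk⟩ := (AddCircle.coe_eq_zero_iff (1 : ℝ)).1 h
  refine ⟨q * k, ?_⟩
  rw [twistedState, ← mul_sub, ← hk]
  push_cast
  simp
  ring

lemma twistedState_angle_add (q : ℕ) (x y : UnitAddCircle) :
    (twistedState q (x + y) : Real.Angle) = twistedState q x + twistedState q y := by
  obtain ⟨s, rfl⟩ := QuotientAddGroup.mk_surjective x
  obtain ⟨t, rfl⟩ := QuotientAddGroup.mk_surjective y
  have := twistedState_angle_coe q (s + t)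
  rw [mul_add, Real.Angle.coe_add, ← twistedState_angle_coe, ← twistedState_angle_coe] at this
  exact this

lemma twistedState_angle_sub (q : ℕ) (x y : UnitAddCircle) :
    (twistedState q (x - y) : Real.Angle) = twistedState q x - twistedState q y := by
  rw [eq_sub_iff_add_eq, ← twistedState_angle_add, sub_add_cancel]

@[simp] lemma twistedState_zero (q : ℕ) : twistedState q 0 = 0 := by
  have : (AddCircle.equivIco (1 : ℝ) 0 ((0 : ℝ) : UnitAddCircle)) = ⟨0, by simp⟩ :=
    (AddCircle.equivIco (1 : ℝ) 0).apply_symm_apply ⟨0, by simp⟩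
  change 2 * Real.pi * q * (AddCircle.equivIco (1 : ℝ) 0 ((0 : ℝ) : UnitAddCircle) : ℝ) = 0
  rw [this]; simp

lemma measurable_twistedState (q : ℕ) : Measurable (twistedState q) :=
  measurable_const.mul (measurable_subtype_coe.comp (AddCircle.measurableEquivIco (1 : ℝ) 0).measurable)

lemma measurable_couplingW (r : ℝ) : Measurable (couplingW r) :=
  Measurable.ite (measurableSet_le measurable_norm measurable_const) measurable_const measurable_const

lemma abs_couplingW_le (r : ℝ) (x : UnitAddCircle) : |couplingW r x| ≤ 1 := by
  rw [couplingW]; split_ifs <;> simp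

lemma couplingW_neg (r : ℝ) (x : UnitAddCircle) : couplingW r (-x) = couplingW r x := by
  simp [couplingW]

/-- The shift interaction with kernel `W_r ∘ σ` and phase `Ψ^q ∘ σ`. -/
def couplingInteraction {Ω : Type} [TopologicalSpace Ω] [MeasurableSpace Ω]
    [OpensMeasurableSpace Ω] (r : ℝ) (q : ℕ) (σ : C(Ω, UnitAddCircle)) {m : ℕ} (c : Fin m → ℝ)
    (τ : Fin m → C(Ω, UnitAddCircle)) : ShiftInteraction Ω where
  arity := m
  coef := c
  shift := τ
  kernel := fun w => couplingW r (σ w)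
  phase := fun w => twistedState q (σ w)
  measurable_kernel := (measurable_couplingW r).comp σ.continuous.measurable
  measurable_phase := (measurable_twistedState q).comp σ.continuous.measurable
  abs_kernel_le := fun _ => abs_couplingW_le r _

lemma comb_couplingInteraction {Ω : Type} [TopologicalSpace Ω] [MeasurableSpace Ω]
    [OpensMeasurableSpace Ω] (r : ℝ) (q : ℕ) (σ : C(Ω, UnitAddCircle)) {m : ℕ} (c : Fin m → ℝ)
    (τ : Fin m → C(Ω, UnitAddCircle)) (f : UnitAddCircle → ℝ) (p : Ω × UnitAddCircle) :
    (couplingInteraction r q σ c τ).comb f p = ∑ j, c j * f (p.2 + τ j p.1) := rfl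

/-- The pairwise interaction. -/
def pairInteraction (r : ℝ) (q : ℕ) : ShiftInteraction UnitAddCircle :=
  couplingInteraction r q (ContinuousMap.id _) ![1, -1] ![ContinuousMap.id _, 0]

/-- The triplet interaction. -/
def tripletInteraction (r : ℝ) (q : ℕ) : ShiftInteraction (UnitAddCircle × UnitAddCircle) :=
  couplingInteraction r q ⟨fun w => w.1 + w.2, by fun_prop⟩ ![1, 1, -2]
    ![ContinuousMap.fst, ContinuousMap.snd, 0]

/-- The quadruplet interaction. -/
def quadInteraction (r : ℝ) (q : ℕ) :
    ShiftInteraction (UnitAddCircle × UnitAddCircle × UnitAddCircle) :=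
  couplingInteraction r q ⟨fun w => w.1 - w.2.1 + w.2.2, by fun_prop⟩ ![1, -1, 1, -1]
    ![ContinuousMap.fst, ContinuousMap.fst.comp ContinuousMap.snd,
      ContinuousMap.snd.comp ContinuousMap.snd, 0]

lemma comb_pair (r : ℝ) (q : ℕ) (f : UnitAddCircle → ℝ) (w x : UnitAddCircle) :
    (pairInteraction r q).comb f (w, x) = f (x + w) - f x := by
  rw [pairInteraction, comb_couplingInteraction, Fin.sum_univ_two]
  simp
  ring

lemma comb_triplet (r : ℝ) (q : ℕ) (f : UnitAddCircle → ℝ) (z y x : UnitAddCircle) :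
    (tripletInteraction r q).comb f ((z, y), x) = f (x + z) + f (x + y) - 2 * f x := by
  rw [tripletInteraction, comb_couplingInteraction, Fin.sum_univ_three]
  simp
  ring

lemma comb_quad (r : ℝ) (q : ℕ) (f : UnitAddCircle → ℝ) (z y w x : UnitAddCircle) :
    (quadInteraction r q).comb f ((z, y, w), x) = f (x + z) - f (x + y) + f (x + w) - f x := by
  rw [quadInteraction, comb_couplingInteraction, Fin.sum_univ_four]
  simp
  ring

section Forms

variable (r : ℝ) (q : ℕ) {n : ℕ} (v : H10) (η : Fin n → H10) (x : UnitAddCircle)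

/-- The increment of the twisted state from `x` to `x + w` equals its value at `w` modulo `2π`,
hence only a `w`-dependent phase remains. The triplet and quadruplet versions rest on the same
cancellation, their coefficients also summing to zero. -/
lemma pair_integrand (w : UnitAddCircle) : (pairInteraction r q).integrand v η (w, x) =
    (∏ i, ((η i).rep (x + w) - (η i).rep x)) * iteratedDeriv n Real.sin
      (perturbedState q v (x + w) - perturbedState q v x) := by
  simp only [ShiftInteraction.integrand, comb_pair]
  congr 1
  apply iteratedDeriv_sin_eq_of_angle_eq
  simp only [perturbedState, pairInteraction, couplingInteraction, Real.Angle.coe_add,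
    Real.Angle.coe_sub, twistedState_angle_add, ContinuousMap.id_apply]
  abel

lemma triplet_integrand (z y : UnitAddCircle) :
    (tripletInteraction r q).integrand v η ((z, y), x) =
    (∏ i, ((η i).rep (x + z) + (η i).rep (x + y) - 2 * (η i).rep x)) * iteratedDeriv n Real.sin
      (perturbedState q v (x + z) + perturbedState q v (x + y) - 2 * perturbedState q v x) := by
  simp only [ShiftInteraction.integrand, comb_triplet]
  congr 1
  apply iteratedDeriv_sin_eq_of_angle_eq
  simp only [perturbedState, tripletInteraction, couplingInteraction, two_mul, Real.Angle.coe_add,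
    Real.Angle.coe_sub, twistedState_angle_add, ContinuousMap.coe_mk]
  abel

lemma quad_integrand (z y w : UnitAddCircle) :
    (quadInteraction r q).integrand v η ((z, y, w), x) =
    (∏ i, ((η i).rep (x + z) - (η i).rep (x + y) + (η i).rep (x + w) - (η i).rep x)) *
      iteratedDeriv n Real.sin (perturbedState q v (x + z) - perturbedState q v (x + y) +
        perturbedState q v (x + w) - perturbedState q v x) := by
  simp only [ShiftInteraction.integrand, comb_quad]
  congr 1
  apply iteratedDeriv_sin_eq_of_angle_eq
  simp only [perturbedState, quadInteraction, couplingInteraction, Real.Angle.coe_add,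
    Real.Angle.coe_sub, twistedState_angle_add, twistedState_angle_sub, ContinuousMap.coe_mk]
  abel

lemma perturbedState_zero : perturbedState q v 0 = 0 := by
  simp [perturbedState, v.rep_zero]

/-- The substitution `y = x + w`, together with evenness of `W_r` since the kernel is written with
`x - y`. -/
lemma pair_form : (pairInteraction r q).form v η x =
    ∫ y, couplingW r (x - y) * (∏ i, ((η i).rep y - (η i).rep x)) *
      iteratedDeriv n Real.sin (perturbedState q v y - perturbedState q v x) := by
  refine Eq.trans ?_ (integral_add_left_eq_self _ x)
  refine integral_congr_ae (Filter.Eventually.of_forall fun w => ?_)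
  simp only [pair_integrand]
  rw [show x - (x + w) = -w by abel, couplingW_neg, mul_assoc]
  rfl

lemma pair_form_zero : (pairInteraction r q).form v η 0 =
    ∫ y, couplingW r y * (∏ i, (η i).rep y) * iteratedDeriv n Real.sin (perturbedState q v y) := by
  rw [pair_form]
  simp [perturbedState_zero, H10.rep_zero, couplingW_neg]

lemma triplet_form : (tripletInteraction r q).form v η x =
    ∫ z, ∫ y, couplingW r (z + y - 2 • x) *
      (∏ i, ((η i).rep z + (η i).rep y - 2 * (η i).rep x)) * iteratedDeriv n Real.sin
        (perturbedState q v z + perturbedState q v y - 2 * perturbedState q v x) := by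
  refine Eq.trans ?_ (integral_add_left_eq_self _ x)
  refine (integral_prod _ ((tripletInteraction r q).integrable_kernel_integrand v η x)).trans ?_
  refine integral_congr_ae (Filter.Eventually.of_forall fun z => ?_)
  simp only
  refine Eq.trans ?_ (integral_add_left_eq_self _ x)
  refine integral_congr_ae (Filter.Eventually.of_forall fun y => ?_)
  simp only [triplet_integrand]
  rw [show x + z + (x + y) - 2 • x = z + y by rw [two_nsmul]; abel, mul_assoc]
  rfl

lemma triplet_form_zero : (tripletInteraction r q).form v η 0 =
    ∫ z, ∫ y, couplingW r (z + y) * (∏ i, ((η i).rep z + (η i).rep y)) * iteratedDeriv n Real.sin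
        (perturbedState q v z + perturbedState q v y) := by
  rw [triplet_form]
  simp [perturbedState_zero, H10.rep_zero]

lemma quad_form : (quadInteraction r q).form v η x =
    ∫ z, ∫ y, ∫ w, couplingW r (z - y + w - x) *
      (∏ i, ((η i).rep z - (η i).rep y + (η i).rep w - (η i).rep x)) * iteratedDeriv n Real.sin
        (perturbedState q v z - perturbedState q v y + perturbedState q v w -
          perturbedState q v x) := by
  refine Eq.trans ?_ (integral_add_left_eq_self _ x)
  have hm := (quadInteraction r q).measurable_kernel_integrand v η x
  have hb := (quadInteraction r q).abs_kernel_integrand_le v η x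
  refine (integral_prod _ ((quadInteraction r q).integrable_kernel_integrand v η x)).trans ?_
  refine integral_congr_ae (Filter.Eventually.of_forall fun z => ?_)
  simp only
  refine Eq.trans ?_ (integral_add_left_eq_self _ x)
  refine (integral_prod _ (ShiftInteraction.integrable_of_bound
    (hm.comp measurable_prodMk_left) fun p => hb (z, p))).trans ?_
  refine integral_congr_ae (Filter.Eventually.of_forall fun y => ?_)
  simp only
  refine Eq.trans ?_ (integral_add_left_eq_self _ x)
  refine integral_congr_ae (Filter.Eventually.of_forall fun w => ?_)
  simp only [quad_integrand, Function.comp]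
  rw [show x + z - (x + y) + (x + w) - x = z - y + w by abel, mul_assoc]
  rfl

lemma quad_form_zero : (quadInteraction r q).form v η 0 =
    ∫ z, ∫ y, ∫ w, couplingW r (z - y + w) *
      (∏ i, ((η i).rep z - (η i).rep y + (η i).rep w)) * iteratedDeriv n Real.sin
        (perturbedState q v z - perturbedState q v y + perturbedState q v w) := by
  rw [quad_form]
  simp [perturbedState_zero, H10.rep_zero]

lemma multilinearOp_eq (lam mu : ℝ) :
    multilinearOp r lam mu (perturbedState q v) (fun i => (η i).rep) x =
      ((pairInteraction r q).form v η x - (pairInteraction r q).form v η 0) +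
      lam * ((tripletInteraction r q).form v η x - (tripletInteraction r q).form v η 0) +
      mu * ((quadInteraction r q).form v η x - (quadInteraction r q).form v η 0) := by
  rw [pair_form, pair_form_zero, triplet_form, triplet_form_zero, quad_form, quad_form_zero]
  rfl

end Forms

/-! ### The phase operator and its derivatives -/

lemma phaseRHS_eq (r lam mu : ℝ) (Ψ : UnitAddCircle → ℝ) (η : Fin 0 → UnitAddCircle → ℝ)
    (x : UnitAddCircle) : phaseRHS r lam mu Ψ x = multilinearOp r lam mu Ψ η x := by
  simp [phaseRHS, multilinearOp]

/-- The right-hand side of the phase-difference system as an operator on `H¹₀`. -/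
def phaseOp (r lam mu : ℝ) (q : ℕ) (v : H10) : H10 :=
  (pairInteraction r q).op v + lam • (tripletInteraction r q).op v +
    mu • (quadInteraction r q).op v

lemma contDiff_phaseOp (r lam mu : ℝ) (q : ℕ) : ContDiff ℝ ∞ (phaseOp r lam mu q) :=
  ((pairInteraction r q).contDiff_op.add ((tripletInteraction r q).contDiff_op.const_smul lam)).add
    ((quadInteraction r q).contDiff_op.const_smul mu)

lemma iteratedFDeriv_phaseOp (r lam mu : ℝ) (q : ℕ) {n : ℕ} (v : H10) (η : Fin n → H10) :
    iteratedFDeriv ℝ n (phaseOp r lam mu q) v η =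
      iteratedFDeriv ℝ n (pairInteraction r q).op v η +
      lam • iteratedFDeriv ℝ n (tripletInteraction r q).op v η +
      mu • iteratedFDeriv ℝ n (quadInteraction r q).op v η := by
  have hn : ∀ {f : H10 → H10}, ContDiff ℝ ∞ f → ContDiffAt ℝ n f v := fun h =>
    (h.of_le (by exact_mod_cast le_top)).contDiffAt
  have h1 := hn (pairInteraction r q).contDiff_op
  have h2 := hn (tripletInteraction r q).contDiff_op
  have h3 := hn (quadInteraction r q).contDiff_op
  have e : phaseOp r lam mu q = ((pairInteraction r q).op + lam • (tripletInteraction r q).op) +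
    mu • (quadInteraction r q).op := rfl
  have h2' : ContDiffAt ℝ n (lam • (tripletInteraction r q).op) v := h2.const_smul lam
  have h3' : ContDiffAt ℝ n (mu • (quadInteraction r q).op) v := h3.const_smul mu
  have h12 : ContDiffAt ℝ n ((pairInteraction r q).op + lam • (tripletInteraction r q).op) v :=
    h1.add h2'
  rw [e, iteratedFDeriv_add_apply h12 h3', iteratedFDeriv_add_apply h1 h2',
    iteratedFDeriv_const_smul_apply h2, iteratedFDeriv_const_smul_apply h3]
  rfl

lemma rep_iteratedFDeriv_phaseOp (r lam mu : ℝ) (q : ℕ) {n : ℕ} (v : H10) (η : Fin n → H10)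
    (x : UnitAddCircle) : (iteratedFDeriv ℝ n (phaseOp r lam mu q) v η).rep x =
      multilinearOp r lam mu (perturbedState q v) (fun i => (η i).rep) x := by
  rw [iteratedFDeriv_phaseOp, multilinearOp_eq]
  simp [H10.rep_add, H10.rep_smul, ShiftInteraction.rep_iteratedFDeriv_op]

lemma rep_phaseOp (r lam mu : ℝ) (q : ℕ) (v : H10) (x : UnitAddCircle) :
    (phaseOp r lam mu q v).rep x = phaseRHS r lam mu (perturbedState q v) x := by
  rw [phaseRHS_eq r lam mu _ (fun i => ((Fin.elim0 i : H10)).rep),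
    ← rep_iteratedFDeriv_phaseOp (n := 0), iteratedFDeriv_zero_apply]

/-! ### Norm bounds for the derivatives -/

lemma norm_pair_combL_le (r : ℝ) (q : ℕ) (g : CircleL2) (hg : ∫ x, g x = 0) :
    ‖(pairInteraction r q).combL g‖ ≤ √2 * ‖g‖ := by
  set S := pairInteraction r q
  have hA := S.measurePreserving_shift (0 : Fin 2)
  have hB : MeasurePreserving (Prod.snd : UnitAddCircle × UnitAddCircle → UnitAddCircle)
    volume volume := measurePreserving_snd
  set A := Lp.compMeasurePreserving _ hA g
  set B := Lp.compMeasurePreserving _ hB g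
  have hAe : A =ᵐ[volume] fun p => g (p.2 + p.1) := Lp.coeFn_compMeasurePreserving g hA
  have hBe : B =ᵐ[volume] fun p => g p.2 := Lp.coeFn_compMeasurePreserving g hB
  have e : S.combL g = A - B := by
    apply Lp.ext
    filter_upwards [S.coeFn_combL g, Lp.coeFn_sub A B, hAe, hBe] with p h1 h2 h3 h4
    rw [h1, h2, Pi.sub_apply, h3, h4]
    exact comb_pair r q g p.1 p.2
  -- Integrating the shifted copy over the shift first yields the mean of `g`, which is zero.
  -- Pythagoras then gives `√2` where the triangle inequality gives `2`.
  have hin : inner ℝ A B = 0 := by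
    rw [L2.inner_def]
    have hi := L2.integrable_inner (𝕜 := ℝ) A B
    have h2 : (fun p => inner ℝ (A p) (B p)) =ᵐ[volume]
        fun p : UnitAddCircle × UnitAddCircle => g p.2 * g (p.2 + p.1) := by
      filter_upwards [hAe, hBe] with p h3 h4
      rw [h3, h4]; simp
    rw [integral_congr_ae h2]
    refine (integral_prod_symm _ (hi.congr h2)).trans ?_
    rw [← integral_zero UnitAddCircle ℝ]
    refine integral_congr_ae (Filter.Eventually.of_forall fun y => ?_)
    simp only
    rw [integral_const_mul, integral_add_left_eq_self (fun x => g x) y, hg, mul_zero]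
  have hsq : ‖S.combL g‖ ^ 2 = 2 * ‖g‖ ^ 2 := by
    rw [e, norm_sub_sq_real, hin, Lp.norm_compMeasurePreserving, Lp.norm_compMeasurePreserving]
    ring
  have h2 := Real.sq_sqrt (show (0 : ℝ) ≤ 2 by norm_num)
  refine (abs_le_of_sq_le_sq' ?_ (by positivity)).2
  rw [hsq, mul_pow, h2]

/-- The cross term `4πq ∫ Dv` vanishes, so `‖2πq + Dv‖² = (2πq)² + ‖Dv‖²`. -/
lemma norm_weakD_sq_le_perturbedStateNormSq (q : ℕ) (v : H10) :
    ‖v.weakD‖ ^ 2 ≤ perturbedStateNormSq q v := by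
  have h1 : ∫ x, (2 * Real.pi * q + v.weakD x) ^ 2 =
      (2 * Real.pi * q) ^ 2 + ∫ x, v.weakD x ^ 2 := by
    have e : ∀ x, (2 * Real.pi * q + v.weakD x) ^ 2 =
        (2 * Real.pi * q) ^ 2 + 2 * (2 * Real.pi * q) * v.weakD x + v.weakD x ^ 2 := fun x => by ring
    simp_rw [e]
    have hi := (L2_integrable v.weakD).const_mul (2 * (2 * Real.pi * q))
    have hj : Integrable fun x => (2 * Real.pi * q) ^ 2 + 2 * (2 * Real.pi * q) * v.weakD x :=
      (integrable_const _).add hi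
    rw [integral_add hj (Lp.memLp v.weakD).integrable_sq,
      integral_add (integrable_const _) hi, integral_const_mul,
      show ∫ x, v.weakD x = 0 from integral_weakD_eq_zero v.2.1]
    simp
  rw [perturbedStateNormSq, h1, L2_norm_sq]
  have h2 : 0 ≤ ∫ x, perturbedState q v x ^ 2 := integral_nonneg fun x => sq_nonneg _
  nlinarith [sq_nonneg (2 * Real.pi * q)]

lemma ShiftInteraction.norm_weakD_iteratedFDeriv_le_four {Ω : Type} [TopologicalSpace Ω]
    [CompactSpace Ω] [SecondCountableTopology Ω] [MeasureSpace Ω] [BorelSpace Ω]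
    [IsProbabilityMeasure (volume : Measure Ω)] (S : ShiftInteraction Ω)
    (hS : ∑ j, |S.coef j| ≤ 4) {n : ℕ} (v : H10) (η : Fin n → H10) :
    ‖(iteratedFDeriv ℝ n S.op v η).weakD‖ ≤
      4 * (n + 1) * 4 ^ n * (1 + ‖v.weakD‖) * ∏ i, ‖(η i).weakD‖ := by
  refine (S.norm_weakD_iteratedFDeriv_le (a := 4) (s := 4) (by norm_num)
    (fun u p => (S.abs_comb_rep_le u p).trans (by gcongr))
    (fun u => (S.norm_combL_le _).trans (by gcongr)) v η).trans ?_
  have hp : (0 : ℝ) ≤ ∏ i, ‖(η i).weakD‖ := Finset.prod_nonneg fun _ _ => norm_nonneg _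
  refine mul_le_mul_of_nonneg_right ?_ hp
  have h1 : (4 : ℝ) ^ (n - 1) ≤ 4 ^ n := pow_le_pow_right₀ (by norm_num) (Nat.sub_le _ _)
  have hP := norm_nonneg v.weakD
  have h3 : (0 : ℝ) ≤ 4 ^ n := by positivity
  have hn : (0 : ℝ) ≤ n := Nat.cast_nonneg n
  have h2 : (n : ℝ) * 4 ^ (n - 1) ≤ n * 4 ^ n := by gcongr
  have h4 : 0 ≤ (n : ℝ) * 4 ^ n * ‖v.weakD‖ := by positivity
  nlinarith

lemma prod_norm_weakD_sq_le {n : ℕ} (η : Fin n → H10) :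
    (∏ i, ‖(η i).weakD‖) ^ 2 ≤ ∏ i, ‖η i‖ ^ 2 := by
  rw [← Finset.prod_pow]
  exact Finset.prod_le_prod (fun _ _ => by positivity) fun i _ => by
    gcongr; exact (η i).norm_weakD_le

/-- The constant in the bound of the derivatives. -/
def derivBound (lam mu : ℝ) (n : ℕ) : ℝ :=
  5 / 2 * ((1 + |lam| + |mu|) * (4 * (n + 1) * 4 ^ n)) ^ 2

/-- The factor `5/2` is `5/4` from `H10.norm_sq_le` times `2` from `(1 + P)² ≤ 2(1 + P²)`. -/
lemma sq_bound_of_linear_bound {u D K P p N Q : ℝ} (hu : u ≤ 5 / 4 * D ^ 2) (hD0 : 0 ≤ D)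
    (hD : D ≤ K * (1 + P) * p) (hN : P ^ 2 ≤ N) (hQ : p ^ 2 ≤ Q) :
    u ≤ 5 / 2 * K ^ 2 * (1 + N) * Q := by
  have h1 : (1 + P) ^ 2 ≤ 2 * (1 + N) := by nlinarith [sq_nonneg (1 - P)]
  calc u ≤ 5 / 4 * D ^ 2 := hu
    _ ≤ 5 / 4 * (K * (1 + P) * p) ^ 2 := by gcongr
    _ = 5 / 4 * K ^ 2 * ((1 + P) ^ 2 * p ^ 2) := by ring
    _ ≤ 5 / 4 * K ^ 2 * (2 * (1 + N) * Q) := by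
      refine mul_le_mul_of_nonneg_left (mul_le_mul h1 hQ (sq_nonneg p) ?_) (by positivity)
      exact (sq_nonneg _).trans h1
    _ = 5 / 2 * K ^ 2 * (1 + N) * Q := by ring

lemma norm_iteratedFDeriv_phaseOp_sq_le (r lam mu : ℝ) (q : ℕ) {n : ℕ} (v : H10)
    (η : Fin n → H10) : ‖iteratedFDeriv ℝ n (phaseOp r lam mu q) v η‖ ^ 2 ≤
      derivBound lam mu n * (1 + perturbedStateNormSq q v) * ∏ i, ‖η i‖ ^ 2 := by
  have h1 := (pairInteraction r q).norm_weakD_iteratedFDeriv_le_four (by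
    change ∑ j : Fin 2, |(![1, -1] : Fin 2 → ℝ) j| ≤ 4
    rw [Fin.sum_univ_two]; norm_num) v η
  have h2 := (tripletInteraction r q).norm_weakD_iteratedFDeriv_le_four (by
    change ∑ j : Fin 3, |(![1, 1, -2] : Fin 3 → ℝ) j| ≤ 4
    rw [Fin.sum_univ_three]
    change |(1 : ℝ)| + |(1 : ℝ)| + |(-2 : ℝ)| ≤ 4
    norm_num) v η
  have h3 := (quadInteraction r q).norm_weakD_iteratedFDeriv_le_four (by
    change ∑ j : Fin 4, |(![1, -1, 1, -1] : Fin 4 → ℝ) j| ≤ 4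
    rw [Fin.sum_univ_four]
    change |(1 : ℝ)| + |(-1 : ℝ)| + |(1 : ℝ)| + |(-1 : ℝ)| ≤ 4
    norm_num) v η
  have hD : ‖(iteratedFDeriv ℝ n (phaseOp r lam mu q) v η).weakD‖ ≤
      (1 + |lam| + |mu|) * (4 * (n + 1) * 4 ^ n) * (1 + ‖v.weakD‖) * ∏ i, ‖(η i).weakD‖ := by
    rw [iteratedFDeriv_phaseOp, ← H10.weakDL_apply, map_add, map_add, map_smul, map_smul]
    refine (norm_add₃_le).trans ?_
    rw [norm_smul, norm_smul, Real.norm_eq_abs, Real.norm_eq_abs]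
    have h2' := mul_le_mul_of_nonneg_left h2 (abs_nonneg lam)
    have h3' := mul_le_mul_of_nonneg_left h3 (abs_nonneg mu)
    refine (add_le_add (add_le_add h1 h2') h3').trans (le_of_eq ?_)
    ring
  exact sq_bound_of_linear_bound (H10.norm_sq_le _) (norm_nonneg _) hD
    (norm_weakD_sq_le_perturbedStateNormSq q v) (prod_norm_weakD_sq_le η)

lemma phaseOp_zero_zero (r : ℝ) (q : ℕ) : phaseOp r 0 0 q = (pairInteraction r q).op := by
  funext v; simp [phaseOp]

lemma mul_half_pow_le (n : ℕ) : (n : ℝ) * (1 / 2) ^ (n - 1) ≤ 1 := by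
  cases n with
  | zero => simp
  | succ m =>
    rw [Nat.add_sub_cancel, one_div, inv_pow, ← div_eq_mul_inv, div_le_one (by positivity)]
    exact_mod_cast Nat.lt_two_pow_self

/-- Here `5/2 = 5/4 · (√2)²`. For `n = 0` the claim is `5/2 P² ≤ 10 + 3N`; a factor `2` in place of
`√2` would give `5P²`, which is too large for large `P`. For `n ≥ 1` one has `E ≤ 1 + P/2`, to be
compared with `4 + 4(3 + N)`. -/
lemma pair_sq_bound {u D P p N Q : ℝ} (n : ℕ) (hu : u ≤ 5 / 4 * D ^ 2) (hD0 : 0 ≤ D)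
    (hD : D ≤ √2 * (n * (1 / 2) ^ (n - 1) + (1 / 2) ^ n * P) * p) (hP : 0 ≤ P) (hN : P ^ 2 ≤ N)
    (hQ : p ^ 2 ≤ Q) : u ≤ (4 + (n + 3) * (n + 2 + N)) * Q := by
  set E : ℝ := n * (1 / 2) ^ (n - 1) + (1 / 2) ^ n * P with hE
  have hE0 : 0 ≤ E := by positivity
  have hN0 : 0 ≤ N := (sq_nonneg _).trans hN
  have key : 5 / 2 * E ^ 2 ≤ 4 + (n + 3) * (n + 2 + N) := by
    rcases Nat.eq_zero_or_pos n with h0 | hpos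
    · have : E = P := by rw [hE, h0]; simp
      rw [this, h0]; push_cast; nlinarith
    · have h1 : E ≤ 1 + 1 / 2 * P := by
        have h2 : (1 / 2 : ℝ) ^ n ≤ 1 / 2 :=
          pow_le_of_le_one (by norm_num) (by norm_num) hpos.ne'
        exact add_le_add (mul_half_pow_le n) (by gcongr)
      have h3 : E ^ 2 ≤ (1 + 1 / 2 * P) ^ 2 := by gcongr
      have hn : (1 : ℝ) ≤ n := by exact_mod_cast hpos
      have h4 : 4 * (3 + N) ≤ ((n : ℝ) + 3) * (n + 2 + N) := by
        apply mul_le_mul <;> linarith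
      nlinarith [sq_nonneg (P - 2)]
  calc u ≤ 5 / 4 * D ^ 2 := hu
    _ ≤ 5 / 4 * (√2 * E * p) ^ 2 := by gcongr
    _ = 5 / 2 * E ^ 2 * p ^ 2 := by
      rw [mul_pow, mul_pow, Real.sq_sqrt (by norm_num)]; ring
    _ ≤ _ := mul_le_mul key hQ (by positivity) (le_trans (by positivity) key)

lemma norm_iteratedFDeriv_pair_sq_le (r : ℝ) (q : ℕ) {n : ℕ} (v : H10)
    (η : Fin n → H10) : ‖iteratedFDeriv ℝ n (phaseOp r 0 0 q) v η‖ ^ 2 ≤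
      (4 + (n + 3) * (n + 2 + perturbedStateNormSq q v)) * ∏ i, ‖η i‖ ^ 2 := by
  have h := (pairInteraction r q).norm_weakD_iteratedFDeriv_le (a := 1 / 2) (s := √2) (by norm_num)
    (fun u p => by
      rw [show p = (p.1, p.2) from rfl, comb_pair]
      exact u.abs_rep_sub_le _ _)
    (fun u => norm_pair_combL_le r q u.weakD (integral_weakD_eq_zero u.2.1)) v η
  rw [phaseOp_zero_zero]
  exact pair_sq_bound n (H10.norm_sq_le _) (norm_nonneg _) h (norm_nonneg _)
    (norm_weakD_sq_le_perturbedStateNormSq q v) (prod_norm_weakD_sq_le η)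

/-! ### Trigonometric functions and the Schauder basis -/

lemma IsCirclePrim.integral_eq_zero {f g : UnitAddCircle → ℝ} (h : IsCirclePrim f g) :
    ∫ x, g x = 0 := by
  have h1 : ((0 + 1 : ℝ) : UnitAddCircle) = ((0 : ℝ) : UnitAddCircle) := by
    rw [zero_add, AddCircle.coe_period]; rfl
  rw [integral_circle_eq g 0, h.integral_eq 0 (0 + 1), h1, sub_self]

lemma isCirclePrim_circleSin (k : ℤ) :
    IsCirclePrim (circleSin k) ((2 * Real.pi * k) • circleCos k : C(UnitAddCircle, ℝ)) :=
  isCirclePrim_of_contDiff ((contDiff_circleSin k).of_le (by simp)) (hasDerivAt_circleSin k)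

lemma isCirclePrim_circleCos (k : ℤ) :
    IsCirclePrim (circleCos k) (-(2 * Real.pi * k) • circleSin k : C(UnitAddCircle, ℝ)) :=
  isCirclePrim_of_contDiff ((contDiff_circleCos k).of_le (by simp)) (hasDerivAt_circleCos k)

lemma circleCos_zero (x : UnitAddCircle) : circleCos 0 x = 1 := by simp [circleCos]

lemma circleSin_zero (x : UnitAddCircle) : circleSin 0 x = 0 := by simp [circleSin]

lemma circleCos_at_zero (k : ℤ) : circleCos k 0 = 1 := by
  have := circleCos_coe k 0; simpa using this

lemma circleSin_at_zero (k : ℤ) : circleSin k 0 = 0 := by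
  have := circleSin_coe k 0; simpa using this

lemma integral_circleCos (k : ℤ) : ∫ x, circleCos k x = if k = 0 then 1 else 0 := by
  split_ifs with hk
  · subst hk; simp [circleCos_zero]
  · have h := (isCirclePrim_circleSin k).integral_eq_zero
    simp only [ContinuousMap.smul_apply, smul_eq_mul] at h
    rw [integral_const_mul] at h
    have : 2 * Real.pi * (k : ℝ) ≠ 0 := by positivity
    exact (mul_eq_zero.1 h).resolve_left this

lemma integral_circleSin (k : ℤ) : ∫ x, circleSin k x = 0 := by
  by_cases hk : k = 0
  · subst hk; simp [circleSin_zero]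
  · have h := (isCirclePrim_circleCos k).integral_eq_zero
    simp only [ContinuousMap.smul_apply, smul_eq_mul] at h
    rw [integral_const_mul] at h
    have : -(2 * Real.pi * (k : ℝ)) ≠ 0 := neg_ne_zero.2 (by positivity)
    exact (mul_eq_zero.1 h).resolve_left this

lemma circleCos_mul_circleCos (a b : ℤ) (x : UnitAddCircle) :
    circleCos a x * circleCos b x = 1 / 2 * circleCos (a - b) x + 1 / 2 * circleCos (a + b) x := by
  induction x using QuotientAddGroup.induction_on with
  | H t =>
    simp only [circleCos_coe]
    push_cast
    rw [mul_add, mul_sub, add_mul, sub_mul, Real.cos_add, Real.cos_sub]; ring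

lemma circleSin_mul_circleSin (a b : ℤ) (x : UnitAddCircle) :
    circleSin a x * circleSin b x = 1 / 2 * circleCos (a - b) x - 1 / 2 * circleCos (a + b) x := by
  induction x using QuotientAddGroup.induction_on with
  | H t =>
    simp only [circleCos_coe, circleSin_coe]
    push_cast
    rw [mul_add, mul_sub, add_mul, sub_mul, Real.cos_add, Real.cos_sub]; ring

lemma circleSin_mul_circleCos (a b : ℤ) (x : UnitAddCircle) :
    circleSin a x * circleCos b x = 1 / 2 * circleSin (a - b) x + 1 / 2 * circleSin (a + b) x := by
  induction x using QuotientAddGroup.induction_on with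
  | H t =>
    simp only [circleCos_coe, circleSin_coe]
    push_cast
    rw [mul_add, mul_sub, add_mul, sub_mul, Real.sin_add, Real.sin_sub]; ring

lemma integrable_continuousMap (f : C(UnitAddCircle, ℝ)) : Integrable f :=
  f.continuous.integrable_of_hasCompactSupport (HasCompactSupport.of_compactSpace _)

/-- The trigonometric functions `cos (2πkx)`, `sin (2πkx)`, `k = 1, 2, …`, interlaced. -/
def trig (n : ℕ) : C(UnitAddCircle, ℝ) :=
  if Even n then circleCos (n / 2 + 1 : ℕ) else circleSin (n / 2 + 1 : ℕ)

lemma trig_even (j : ℕ) : trig (2 * j) = circleCos (j + 1) := by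
  simp [trig]

lemma trig_odd (j : ℕ) : trig (2 * j + 1) = circleSin (j + 1) := by
  have h : (2 * j + 1) / 2 = j := by omega
  rw [trig, if_neg (by simp), h]
  simp

lemma integral_trig (n : ℕ) : ∫ x, trig n x = 0 := by
  obtain ⟨j, rfl | rfl⟩ := Nat.even_or_odd' n
  · rw [trig_even, integral_circleCos, if_neg (by omega)]
  · rw [trig_odd, integral_circleSin]

lemma integral_half_mul_add (f g : C(UnitAddCircle, ℝ)) :
    ∫ x, (1 / 2 * f x + 1 / 2 * g x) = 1 / 2 * (∫ x, f x) + 1 / 2 * ∫ x, g x := by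
  rw [integral_add ((integrable_continuousMap f).const_mul _)
    ((integrable_continuousMap g).const_mul _), integral_const_mul, integral_const_mul]

lemma integral_half_mul_sub (f g : C(UnitAddCircle, ℝ)) :
    ∫ x, (1 / 2 * f x - 1 / 2 * g x) = 1 / 2 * (∫ x, f x) - 1 / 2 * ∫ x, g x := by
  rw [integral_sub ((integrable_continuousMap f).const_mul _)
    ((integrable_continuousMap g).const_mul _), integral_const_mul, integral_const_mul]

lemma integral_trig_mul_trig (m n : ℕ) :
    ∫ x, trig m x * trig n x = if m = n then 1 / 2 else 0 := by
  obtain ⟨i, rfl | rfl⟩ := Nat.even_or_odd' m <;> obtain ⟨j, rfl | rfl⟩ := Nat.even_or_odd' n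
  · simp only [trig_even, circleCos_mul_circleCos, integral_half_mul_add, integral_circleCos]
    rw [if_neg (show ¬ (i + 1 + (j + 1) : ℤ) = 0 by omega)]
    split_ifs <;> first | omega | norm_num
  · simp only [trig_even, trig_odd, mul_comm (circleCos _ _), circleSin_mul_circleCos,
      integral_half_mul_add, integral_circleSin]
    rw [if_neg (by omega)]; norm_num
  · simp only [trig_even, trig_odd, circleSin_mul_circleCos,
      integral_half_mul_add, integral_circleSin]
    rw [if_neg (by omega)]; norm_num
  · simp only [trig_odd, circleSin_mul_circleSin, integral_half_mul_sub, integral_circleCos]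
    rw [if_neg (show ¬ (i + 1 + (j + 1) : ℤ) = 0 by omega)]
    split_ifs <;> first | omega | norm_num

/-- The `L²` class of a continuous function. -/
abbrev contL2 (f : C(UnitAddCircle, ℝ)) : CircleL2 := ContinuousMap.toLp 2 volume ℝ f

lemma contL2_ae (f : C(UnitAddCircle, ℝ)) : contL2 f =ᵐ[volume] f := ContinuousMap.coeFn_toLp _ _

lemma inner_contL2 (f : C(UnitAddCircle, ℝ)) (g : CircleL2) :
    inner ℝ (contL2 f) g = ∫ x, g x * f x := by
  rw [L2.inner_def]
  apply integral_congr_ae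
  filter_upwards [contL2_ae f] with x hx
  rw [hx]; simp

lemma inner_trig (m n : ℕ) :
    inner ℝ (contL2 (trig m)) (contL2 (trig n)) = if m = n then (1 / 2 : ℝ) else 0 := by
  rw [inner_contL2, ← integral_trig_mul_trig]
  apply integral_congr_ae
  filter_upwards [contL2_ae (trig n)] with x hx
  rw [hx, mul_comm]

/-- The real Fourier system of `L²`. -/
def fourierSystem : Option ℕ → CircleL2
  | none => oneL2
  | some n => √2 • contL2 (trig n)

lemma orthonormal_fourierSystem : Orthonormal ℝ fourierSystem := by
  rw [orthonormal_iff_ite]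
  have h2 := Real.mul_self_sqrt (show (0 : ℝ) ≤ 2 by norm_num)
  have h0 : ∀ n, inner ℝ oneL2 (contL2 (trig n)) = 0 := fun n => by
    rw [inner_oneL2, integral_congr_ae (contL2_ae _), integral_trig]
  rintro (_ | m) (_ | n)
  · simp [fourierSystem, norm_oneL2]
  · simp [fourierSystem, inner_smul_right, h0]
  · simp [fourierSystem, inner_smul_left, real_inner_comm, h0]
  · simp only [fourierSystem, inner_smul_left, inner_smul_right, inner_trig, Option.some.injEq]
    split_ifs
    · simp only [RCLike.conj_to_real]; linarith
    · simp

/-- Cosine is even and sine odd in the frequency, so the nonnegative frequencies already determine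
all Fourier coefficients. -/
lemma span_fourierSystem_orthogonal :
    (Submodule.span ℝ (Set.range fourierSystem))ᗮ = ⊥ := by
  rw [Submodule.eq_bot_iff]
  intro g hg
  have h : ∀ o, inner ℝ (fourierSystem o) g = 0 := fun o =>
    (Submodule.mem_orthogonal _ _).1 hg _ (Submodule.subset_span ⟨o, rfl⟩)
  have ht : ∀ n, ∫ x, g x * trig n x = 0 := fun n => by
    have := h (some n)
    rw [fourierSystem, inner_smul_left, inner_contL2] at this
    exact (mul_eq_zero.1 this).resolve_left (by simp)
  have h1 : ∫ x, g x = 0 := by rw [← inner_oneL2]; exact h none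
  have hc : ∀ j : ℕ, ∫ x, g x * circleCos (j + 1) x = 0 := fun j => trig_even j ▸ ht (2 * j)
  have hs : ∀ j : ℕ, ∫ x, g x * circleSin (j + 1) x = 0 := fun j => trig_odd j ▸ ht (2 * j + 1)
  have ec : ∀ (k : ℤ) (x : UnitAddCircle), circleCos (-k) x = circleCos k x := fun k x => by
    simp [circleCos]
  have es : ∀ (k : ℤ) (x : UnitAddCircle), circleSin (-k) x = -circleSin k x := fun k x => by
    simp [circleSin]
  apply L2_eq_zero_of_fourier
  · intro k
    obtain ⟨n, rfl | rfl⟩ := k.eq_nat_or_neg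
    all_goals cases n with
    | zero => simpa [circleCos_zero] using h1
    | succ j =>
      try simp only [ec]
      exact_mod_cast hc j
  · intro k
    obtain ⟨n, rfl | rfl⟩ := k.eq_nat_or_neg
    all_goals cases n with
    | zero => simp [circleSin_zero]
    | succ j =>
      try simp only [es, mul_neg, integral_neg, neg_eq_zero]
      exact_mod_cast hs j

/-- The real Fourier basis of `L²`. -/
def realFourierBasis : HilbertBasis (Option ℕ) ℝ CircleL2 :=
  HilbertBasis.mkOfOrthogonalEqBot orthonormal_fourierSystem span_fourierSystem_orthogonal

lemma realFourierBasis_apply (o : Option ℕ) : realFourierBasis o = fourierSystem o := by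
  rw [realFourierBasis, HilbertBasis.coe_mkOfOrthogonalEqBot]

/-- The primitives of the functions `2πk · trig`. -/
def trigPrim (n : ℕ) : H10 := H10.primL ((2 * Real.pi * (n / 2 + 1 : ℕ)) • contL2 (trig n))

lemma integral_contL2_trig (n : ℕ) (c : ℝ) : ∫ x, (c • contL2 (trig n) : CircleL2) x = 0 := by
  rw [← inner_oneL2, inner_smul_right, inner_oneL2, integral_congr_ae (contL2_ae _),
    integral_trig, mul_zero]

lemma weakD_trigPrim (n : ℕ) :
    (trigPrim n).weakD = (2 * Real.pi * (n / 2 + 1 : ℕ)) • contL2 (trig n) :=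
  H10.weakD_primL_of_mean_zero (integral_contL2_trig n _)

lemma primL_contL2_rep {p f : C(UnitAddCircle, ℝ)} (hp0 : p 0 = 0) (h : IsCirclePrim p f) :
    (H10.primL (contL2 f)).rep = p := by
  have h' : IsCirclePrim p (contL2 f) := IsPrim.congr_ae h (ae_lift (contL2_ae f))
  obtain ⟨u, hu, hD⟩ := H10.exists_of_isCirclePrim p hp0 _ h'
  rw [← hD, H10.primL_weakD, hu]

lemma trigPrim_even_rep (j : ℕ) : (trigPrim (2 * j)).rep = circleSin (j + 1) := by
  have h := isCirclePrim_circleSin (j + 1)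
  rw [trigPrim, trig_even, contL2, ← map_smul]
  refine primL_contL2_rep (circleSin_at_zero _) ?_
  simpa using h

lemma trigPrim_odd_rep (j : ℕ) : (trigPrim (2 * j + 1)).rep = 1 - circleCos (j + 1) := by
  have e : (2 * j + 1) / 2 = j := by omega
  rw [trigPrim, trig_odd, contL2, ← map_smul, e]
  refine primL_contL2_rep (by simp [circleCos_at_zero]) ?_
  have h := (IsPrim.const 1).sub (isCirclePrim_circleCos (j + 1))
  refine IsPrim.congr h (fun t => by simp) fun t => by simp

/-- The coordinate functionals of the basis `trigPrim`. -/
def trigCoord (n : ℕ) : StrongDual ℝ H10 :=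
  (Real.pi * (n / 2 + 1 : ℕ))⁻¹ • (innerSL ℝ (contL2 (trig n))).comp H10.weakDL

lemma trigCoord_apply (n : ℕ) (u : H10) : trigCoord n u =
    (Real.pi * (n / 2 + 1 : ℕ))⁻¹ * inner ℝ (contL2 (trig n)) u.weakD := rfl

/-- The Fourier expansion of `Du` is carried to `u` by the bounded operator `primL`, which is a left
inverse of the weak derivative. -/
lemma hasSum_trigPrim (u : H10) : HasSum (fun n => trigCoord n u • trigPrim n) u := by
  have h := (realFourierBasis.hasSum_repr u.weakD).mapL H10.primL
  rw [H10.primL_weakD] at h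
  -- The constant mode `none` can be dropped because `primL` kills constants.
  rw [← (Option.some_injective ℕ).hasSum_iff] at h
  · convert h using 1
    funext n
    have h2 := Real.mul_self_sqrt (show (0 : ℝ) ≤ 2 by norm_num)
    have hk : Real.pi * ((n / 2 + 1 : ℕ) : ℝ) ≠ 0 := by positivity
    simp only [Function.comp, HilbertBasis.repr_apply_apply, realFourierBasis_apply, fourierSystem,
      inner_smul_left, map_smul, trigCoord_apply, trigPrim, smul_smul, RCLike.conj_to_real]
    congr 1
    -- The two normalizations `√2` multiply to `2`, which equals `(πk)⁻¹ · 2πk` with `k = n / 2 +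
    -- 1`.
    rw [mul_right_comm (√2), h2]
    field_simp
  · rintro (_ | n) hn
    · simp [realFourierBasis_apply, fourierSystem, H10.primL_oneL2]
    · exact absurd ⟨n, rfl⟩ hn

/-- The Schauder basis of `H¹₀` formed by `sin (2πkx)`, `1 - cos (2πkx)`, `k = 1, 2, …`. -/
def trigSchauderBasis : SchauderBasis ℝ H10 where
  basis := trigPrim
  coord := trigCoord
  ortho i j := by
    rw [trigCoord_apply, weakD_trigPrim, inner_smul_right, inner_trig]
    rcases eq_or_ne i j with rfl | h
    · have hk : Real.pi * ((i / 2 + 1 : ℕ) : ℝ) ≠ 0 := by positivity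
      refine Eq.trans ?_ (by simp : (1 : ℝ) = _)
      rw [if_pos rfl]
      field_simp
    · simp [h]
  -- The expansion converges unconditionally, hence also in the order `u₁, w₁, u₂, w₂, …`.
  expansion u := (hasSum_trigPrim u).mono_left SummationFilter.le_atTop

/-! ### The linearization at a twisted state -/

lemma cos_twistedState (q : ℕ) (x : UnitAddCircle) :
    Real.cos (twistedState q x) = circleCos q x := by
  induction x using QuotientAddGroup.induction_on with
  | H t =>
    rw [← Real.Angle.cos_coe, twistedState_angle_coe, Real.Angle.cos_coe, circleCos_coe]
    simp

lemma couplingW_eq_indicator {r t : ℝ} (ht : |t| ≤ 1 / 2) (g : ℝ → ℝ) :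
    couplingW r (t : UnitAddCircle) * g t = (Set.Icc (-r) r).indicator g t := by
  have h : ‖(t : UnitAddCircle)‖ = |t| :=
    (AddCircle.norm_coe_eq_abs_iff 1 one_ne_zero).2 (by simpa using ht)
  rw [couplingW, h]
  simp only [Set.indicator_apply, Set.mem_Icc, ← abs_le]
  split_ifs <;> simp

/-- The fundamental interval is centred at `0`, where the quotient norm is `|t|`, and `r ≤ 1/2`
makes `[-r, r]` fit. Closed intervals cover the case `r = 1/2`, where the endpoint `-1/2` belongs to
the support. -/
lemma integral_couplingW_mul {r : ℝ} (h0 : 0 < r) (h1 : r ≤ 1 / 2) (f : UnitAddCircle → ℝ) :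
    ∫ x, couplingW r x * f x = ∫ t in (-r)..r, f (t : UnitAddCircle) := by
  rw [integral_circle_eq _ (-1 / 2), intervalIntegral.integral_of_le (by norm_num),
    intervalIntegral.integral_of_le (by linarith), ← integral_Icc_eq_integral_Ioc,
    ← integral_Icc_eq_integral_Ioc, ← Set.inter_eq_right.2
      (Set.Icc_subset_Icc (by linarith : (-1 / 2 : ℝ) ≤ -r) (by linarith : r ≤ -1 / 2 + 1)),
    ← setIntegral_indicator measurableSet_Icc]
  refine setIntegral_congr_fun measurableSet_Icc fun t ht => ?_
  exact couplingW_eq_indicator (abs_le.2 ⟨by linarith [ht.1], by linarith [ht.2]⟩)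
    fun t : ℝ => f (t : UnitAddCircle)

lemma integral_couplingW_mul_circleCos {r : ℝ} (h0 : 0 < r) (h1 : r ≤ 1 / 2) (k : ℤ) :
    ∫ x, couplingW r x * circleCos k x = couplingCoeff r k / 2 := by
  rw [integral_couplingW_mul h0 h1, couplingCoeff]
  split_ifs with hk
  · subst hk; simp; ring
  · have h := (isCirclePrim_circleSin k).integral_eq (-r) r
    simp only [ContinuousMap.smul_apply, smul_eq_mul] at h
    rw [intervalIntegral.integral_const_mul, circleSin_coe, circleSin_coe, mul_neg,
      Real.sin_neg] at h
    have hk' : (k : ℝ) ≠ 0 := by exact_mod_cast hk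
    rw [div_div, eq_div_iff (by positivity)]
    linear_combination h

lemma integral_couplingW_mul_circleSin (r : ℝ) (k : ℤ) :
    ∫ x, couplingW r x * circleSin k x = 0 := by
  have h := integral_neg_eq_self (fun x => couplingW r x * circleSin k x) volume
  have es : ∀ x : UnitAddCircle, circleSin k (-x) = -circleSin k x := fun x => by
    induction x using QuotientAddGroup.induction_on with
    | H t =>
      have := circleSin_coe k (-t)
      rw [mul_neg, Real.sin_neg, ← circleSin_coe] at this
      exact this
  simp only [couplingW_neg, es, mul_neg, integral_neg] at h
  linarith

/-- The kernel of the linearized interactions at the twisted state. -/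
def linKernel (r : ℝ) (q : ℕ) (x : UnitAddCircle) : ℝ := couplingW r x * circleCos q x

lemma measurable_linKernel (r : ℝ) (q : ℕ) : Measurable (linKernel r q) :=
  (measurable_couplingW r).mul (circleCos q).continuous.measurable

lemma abs_linKernel_le (r : ℝ) (q : ℕ) (x : UnitAddCircle) : |linKernel r q x| ≤ 1 := by
  rw [linKernel, ← cos_twistedState, abs_mul]
  exact mul_le_one₀ (abs_couplingW_le r x) (abs_nonneg _) (Real.abs_cos_le_one _)

/-- At `v = 0` the differentiated sine is the cosine of the phase alone, which is absorbed into
`linKernel`. -/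
lemma couplingInteraction_form_one {Ω : Type} [TopologicalSpace Ω] [CompactSpace Ω]
    [SecondCountableTopology Ω] [MeasureSpace Ω] [BorelSpace Ω]
    [IsProbabilityMeasure (volume : Measure Ω)] (r : ℝ) (q : ℕ) (σ : C(Ω, UnitAddCircle)) {m : ℕ}
    (c : Fin m → ℝ) (τ : Fin m → C(Ω, UnitAddCircle)) (η : H10) (x : UnitAddCircle) :
    (couplingInteraction r q σ c τ).form 0 (fun _ : Fin 1 => η) x =
      ∫ w, linKernel r q (σ w) * (couplingInteraction r q σ c τ).comb η.rep (w, x) := by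
  have h0 : ∀ p, (couplingInteraction r q σ c τ).comb (0 : H10).rep p = 0 := fun p => by
    have : (0 : H10).rep = 0 := map_zero H10.repL
    simp [ShiftInteraction.comb, this]
  refine integral_congr_ae (Filter.Eventually.of_forall fun w => ?_)
  simp only [ShiftInteraction.integrand, h0, add_zero, Fin.prod_univ_one, iteratedDeriv_one,
    Real.deriv_sin, linKernel, ← cos_twistedState]
  simp only [couplingInteraction]
  ring

section Fubini

variable {α : Type} [TopologicalSpace α] [CompactSpace α] [SecondCountableTopology α]
  [MeasureSpace α] [BorelSpace α] [IsProbabilityMeasure (volume : Measure α)]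
  (r : ℝ) (q : ℕ) (s : C(α, UnitAddCircle)) (g : C(α, ℝ))

lemma integrable_linKernel_mul : Integrable fun a => linKernel r q (s a) * g a :=
  ShiftInteraction.integrable_of_bound
    (((measurable_linKernel r q).comp s.continuous.measurable).mul g.continuous.measurable)
    (C := 1 * ‖g‖) fun a => by
      rw [abs_mul]
      exact mul_le_mul (abs_linKernel_le r q _) (g.norm_coe_le_norm a) (abs_nonneg _) zero_le_one

/-- Integrating first over the variable absent from `g`, translation invariance replaces the kernel
by its mean. -/
lemma integral_linKernel_add_mul :
    ∫ p : α × UnitAddCircle, linKernel r q (s p.1 + p.2) * g p.1 =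
      (∫ x, linKernel r q x) * ∫ a, g a := by
  have h := integral_prod _ (integrable_linKernel_mul r q
    ⟨fun p : α × UnitAddCircle => s p.1 + p.2, by fun_prop⟩ (g.comp ContinuousMap.fst))
  simp only [ContinuousMap.coe_mk, ContinuousMap.comp_apply, ContinuousMap.fst_apply] at h
  refine h.trans ?_
  simp only [integral_mul_const]
  simp only [integral_add_left_eq_self (fun y => linKernel r q y), integral_const_mul]

lemma integral_linKernel_add_mul' :
    ∫ p : UnitAddCircle × α, linKernel r q (p.1 + s p.2) * g p.2 =
      (∫ x, linKernel r q x) * ∫ a, g a := by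
  have h := integral_prod_symm _ (integrable_linKernel_mul r q
    ⟨fun p : UnitAddCircle × α => p.1 + s p.2, by fun_prop⟩ (g.comp ContinuousMap.snd))
  simp only [ContinuousMap.coe_mk, ContinuousMap.comp_apply, ContinuousMap.snd_apply] at h
  refine h.trans ?_
  simp only [integral_mul_const]
  simp only [integral_add_right_eq_self (fun y => linKernel r q y), integral_const_mul]

end Fubini

/-- The addTranslate of a continuous function on the circle. -/
def addTranslate (x : UnitAddCircle) (f : C(UnitAddCircle, ℝ)) : C(UnitAddCircle, ℝ) :=
  f.comp ⟨fun y => x + y, by fun_prop⟩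

lemma addTranslate_apply (x : UnitAddCircle) (f : C(UnitAddCircle, ℝ)) (y : UnitAddCircle) :
    addTranslate x f y = f (x + y) := rfl

lemma integral_addTranslate (x : UnitAddCircle) (f : C(UnitAddCircle, ℝ)) :
    ∫ y, addTranslate x f y = ∫ y, f y :=
  integral_add_left_eq_self (fun y => f y) x

/-- Each summand of the combination depends on at most one of `z`, `y`, so the other variable can be
integrated against the kernel alone. -/
lemma triplet_form_one (r : ℝ) (q : ℕ) (η : H10) (x : UnitAddCircle) :
    (tripletInteraction r q).form 0 (fun _ : Fin 1 => η) x =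
      (∫ x, linKernel r q x) * (2 * (∫ y, η.rep y) - 2 * η.rep x) := by
  set f := η.rep
  have h1 := integral_linKernel_add_mul r q (ContinuousMap.id _)
    (addTranslate x f - ContinuousMap.const _ (2 * f x))
  have h2 := integral_linKernel_add_mul' r q (ContinuousMap.id _) (addTranslate x f)
  have i1 := integrable_linKernel_mul r q
    ⟨fun p : UnitAddCircle × UnitAddCircle => p.1 + p.2, by fun_prop⟩
    ((addTranslate x f - ContinuousMap.const _ (2 * f x)).comp ContinuousMap.fst)
  have i2 := integrable_linKernel_mul r q
    ⟨fun p : UnitAddCircle × UnitAddCircle => p.1 + p.2, by fun_prop⟩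
    ((addTranslate x f).comp ContinuousMap.snd)
  have e : ∫ y, (addTranslate x f - ContinuousMap.const _ (2 * f x) : C(UnitAddCircle, ℝ)) y =
      (∫ y, f y) - 2 * f x := by
    simp only [ContinuousMap.sub_apply, ContinuousMap.const_apply]
    rw [integral_sub (integrable_continuousMap _) (integrable_const _), integral_addTranslate]
    simp
  rw [integral_addTranslate] at h2
  rw [e] at h1
  have h3 := (integral_add i1 i2).trans (congrArg₂ (· + ·) h1 h2)
  rw [tripletInteraction, couplingInteraction_form_one, ← tripletInteraction]
  refine Eq.trans (integral_congr_ae (Filter.Eventually.of_forall fun p => ?_)) (h3.trans (by ring))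
  obtain ⟨z, y⟩ := p
  simp only [comb_triplet, ContinuousMap.coe_mk, ContinuousMap.comp_apply, ContinuousMap.sub_apply,
    addTranslate_apply, ContinuousMap.const_apply, ContinuousMap.fst_apply, ContinuousMap.snd_apply]
  ring

/-- The summand in `z` is separated by integrating over `y` and `w`, the others by integrating over
`z`; the means of the `y` and `w` summands cancel. -/
lemma quad_form_one (r : ℝ) (q : ℕ) (η : H10) (x : UnitAddCircle) :
    (quadInteraction r q).form 0 (fun _ : Fin 1 => η) x =
      (∫ x, linKernel r q x) * ((∫ y, η.rep y) - η.rep x) := by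
  set f := η.rep
  set g : C(UnitAddCircle × UnitAddCircle, ℝ) := (addTranslate x f).comp ContinuousMap.snd -
    (addTranslate x f).comp ContinuousMap.fst - ContinuousMap.const _ (f x) with hg
  have h2 := integral_linKernel_add_mul' r q
    ⟨fun p : UnitAddCircle × UnitAddCircle => p.2 - p.1, by fun_prop⟩ g
  have i0 := fun a : C(UnitAddCircle × UnitAddCircle, ℝ) =>
    a.continuous.integrable_of_hasCompactSupport (μ := volume) (HasCompactSupport.of_compactSpace _)
  have e : ∫ p, g p = - f x := by
    have e1 : ∫ p, (addTranslate x f).comp (ContinuousMap.snd (α := UnitAddCircle)) p = ∫ y, f y := by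
      rw [← integral_addTranslate x f]
      exact (integral_fun_snd (μ := (volume : Measure UnitAddCircle))
        (ν := (volume : Measure UnitAddCircle)) (addTranslate x f)).trans (by simp)
    have e2 : ∫ p, (addTranslate x f).comp (ContinuousMap.fst (β := UnitAddCircle)) p = ∫ y, f y := by
      rw [← integral_addTranslate x f]
      exact (integral_fun_fst (μ := (volume : Measure UnitAddCircle))
        (ν := (volume : Measure UnitAddCircle)) (addTranslate x f)).trans (by simp)
    have := integral_sub (i0 ((addTranslate x f).comp ContinuousMap.snd -
      (addTranslate x f).comp ContinuousMap.fst)) (i0 (ContinuousMap.const _ (f x)))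
    refine this.trans ?_
    have := integral_sub (i0 ((addTranslate x f).comp ContinuousMap.snd))
      (i0 ((addTranslate x f).comp ContinuousMap.fst))
    rw [e1, e2] at this
    refine (congrArg (· - _) this).trans ?_
    simp
  have i1 := integrable_linKernel_mul r q
    ⟨fun p : UnitAddCircle × UnitAddCircle × UnitAddCircle => p.1 + (p.2.2 - p.2.1), by fun_prop⟩
    ((addTranslate x f).comp ContinuousMap.fst)
  have i2 := integrable_linKernel_mul r q
    ⟨fun p : UnitAddCircle × UnitAddCircle × UnitAddCircle => p.1 + (p.2.2 - p.2.1), by fun_prop⟩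
    (g.comp ContinuousMap.snd)
  have hin : ∀ z, ∫ p : UnitAddCircle × UnitAddCircle, linKernel r q (z + (p.2 - p.1)) =
      ∫ y, linKernel r q y := fun z => by
    have := integral_linKernel_add_mul r q
      ⟨fun y : UnitAddCircle => z - y, by fun_prop⟩ (ContinuousMap.const _ 1)
    simp only [ContinuousMap.const_apply, mul_one, integral_const, ContinuousMap.coe_mk] at this
    rw [show (∫ y, linKernel r q y) = _ from (this.trans (by simp)).symm]
    congr 1; ext p; congr 1; abel
  have h1 := integral_prod _ i1
  simp only [ContinuousMap.coe_mk, ContinuousMap.comp_apply, ContinuousMap.fst_apply] at h1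
  simp only [integral_mul_const, hin] at h1
  rw [integral_const_mul, integral_addTranslate] at h1
  rw [e] at h2
  have h3 := (integral_add i1 i2).trans (congrArg₂ (· + ·) h1 h2)
  rw [quadInteraction, couplingInteraction_form_one, ← quadInteraction]
  refine Eq.trans (integral_congr_ae (Filter.Eventually.of_forall fun p => ?_)) (h3.trans (by ring))
  obtain ⟨z, y, w⟩ := p
  simp only [comb_quad, ContinuousMap.coe_mk, ContinuousMap.comp_apply, ContinuousMap.sub_apply, hg,
    addTranslate_apply, ContinuousMap.const_apply, ContinuousMap.fst_apply, ContinuousMap.snd_apply]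
  rw [show z - y + w = z + (w - y) by abel]
  ring

lemma integrable_couplingW_mul (r : ℝ) (f : C(UnitAddCircle, ℝ)) :
    Integrable fun x => couplingW r x * f x :=
  (integrable_continuousMap f).bdd_mul (c := 1) (measurable_couplingW r).aestronglyMeasurable
    (Filter.Eventually.of_forall fun x => abs_couplingW_le r x)

lemma integral_linKernel {r : ℝ} (h0 : 0 < r) (h1 : r ≤ 1 / 2) (q : ℕ) :
    ∫ x, linKernel r q x = couplingCoeff r q / 2 := integral_couplingW_mul_circleCos h0 h1 q

lemma integral_linKernel_mul_circleCos {r : ℝ} (h0 : 0 < r) (h1 : r ≤ 1 / 2) (q : ℕ) (k : ℤ) :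
    ∫ x, linKernel r q x * circleCos k x =
      (couplingCoeff r (q - k) + couplingCoeff r (q + k)) / 4 := by
  have e : ∀ x, linKernel r q x * circleCos k x =
      1 / 2 * (couplingW r x * circleCos (q - k) x) +
      1 / 2 * (couplingW r x * circleCos (q + k) x) := fun x => by
    rw [linKernel, mul_assoc, circleCos_mul_circleCos]; ring
  simp only [e]
  rw [integral_add ((integrable_couplingW_mul r _).const_mul _)
    ((integrable_couplingW_mul r _).const_mul _), integral_const_mul, integral_const_mul,
    integral_couplingW_mul_circleCos h0 h1, integral_couplingW_mul_circleCos h0 h1]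
  ring

lemma integral_linKernel_mul_circleSin (r : ℝ) (q : ℕ) (k : ℤ) :
    ∫ x, linKernel r q x * circleSin k x = 0 := by
  have e : ∀ x, linKernel r q x * circleSin k x =
      1 / 2 * (couplingW r x * circleSin (k - q) x) +
      1 / 2 * (couplingW r x * circleSin (k + q) x) := fun x => by
    rw [linKernel, mul_assoc, mul_comm (circleCos _ _), circleSin_mul_circleCos]; ring
  simp only [e]
  rw [integral_add ((integrable_couplingW_mul r _).const_mul _)
    ((integrable_couplingW_mul r _).const_mul _), integral_const_mul, integral_const_mul,
    integral_couplingW_mul_circleSin, integral_couplingW_mul_circleSin]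
  ring

/-- The sine part drops out because the kernel is even, so only the coefficient `a` survives. -/
lemma pair_form_one {r : ℝ} (h0 : 0 < r) (h1 : r ≤ 1 / 2) (q : ℕ) (k : ℤ) (η : H10)
    (x : UnitAddCircle) {a b : ℝ} (h : ∀ w, η.rep (x + w) - η.rep x =
      a * (circleCos k w - 1) + b * circleSin k w) :
    (pairInteraction r q).form 0 (fun _ : Fin 1 => η) x =
      a * ((couplingCoeff r (q - k) + couplingCoeff r (q + k) - 2 * couplingCoeff r q) / 4) := by
  have e : ∀ w, linKernel r q w * (η.rep (x + w) - η.rep x) =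
      a * (linKernel r q w * circleCos k w) - a * linKernel r q w +
        b * (linKernel r q w * circleSin k w) := fun w => by rw [h]; ring
  have i := fun f => integrable_linKernel_mul r q (ContinuousMap.id UnitAddCircle) f
  have i1 : Integrable fun w => a * (linKernel r q w * circleCos k w) := (i _).const_mul a
  have i2 : Integrable fun w => a * linKernel r q w :=
    (integrable_couplingW_mul r (circleCos q)).const_mul a
  have i3 : Integrable fun w => b * (linKernel r q w * circleSin k w) := (i _).const_mul b
  have i12 : Integrable fun w => a * (linKernel r q w * circleCos k w) - a * linKernel r q w :=
    i1.sub i2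
  rw [pairInteraction, couplingInteraction_form_one, ← pairInteraction]
  simp only [comb_pair, ContinuousMap.id_apply, e]
  rw [integral_add i12 i3, integral_sub i1 i2, integral_const_mul, integral_const_mul,
    integral_const_mul, integral_linKernel_mul_circleSin, integral_linKernel_mul_circleCos h0 h1,
    integral_linKernel h0 h1]
  ring

/-- If the increments of `η` are combinations of `cos (2πk·) - 1` and `sin (2πk·)`, then `η` is an
eigenvector of the linearization at the twisted state. -/
lemma fderiv_phaseOp_eq_smul {r : ℝ} (h0 : 0 < r) (h1 : r ≤ 1 / 2) (lam mu : ℝ) (q : ℕ) (k : ℤ)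
    (η : H10) (a b : UnitAddCircle → ℝ) (h : ∀ x w, η.rep (x + w) - η.rep x =
      a x * (circleCos k w - 1) + b x * circleSin k w) (ha : ∀ x, a x - a 0 = η.rep x) :
    fderiv ℝ (phaseOp r lam mu q) 0 η = eigenvalueC1 q k r lam mu • η := by
  have e : fderiv ℝ (phaseOp r lam mu q) 0 η =
      iteratedFDeriv ℝ 1 (phaseOp r lam mu q) 0 fun _ : Fin 1 => η :=
    (iteratedFDeriv_one_apply (𝕜 := ℝ) (f := phaseOp r lam mu q) (x := 0) fun _ : Fin 1 => η).symm
  apply H10.eq_of_rep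
  intro x
  -- Subtracting the forms at `0` removes the means of `η` from the higher-order terms and turns `a
  -- x` into `a x - a 0 = η x` in the pairwise one.
  rw [e, rep_iteratedFDeriv_phaseOp, multilinearOp_eq, pair_form_one h0 h1 q k η x (h x),
    pair_form_one h0 h1 q k η 0 (h 0), triplet_form_one, triplet_form_one, quad_form_one,
    quad_form_one, integral_linKernel h0 h1, H10.rep_smul, ContinuousMap.smul_apply, smul_eq_mul,
    η.rep_zero, ← ha x, eigenvalueC1]
  ring

lemma circleSin_add (k : ℤ) (x w : UnitAddCircle) :
    circleSin k (x + w) = circleSin k x * circleCos k w + circleCos k x * circleSin k w := by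
  obtain ⟨s, rfl⟩ := QuotientAddGroup.mk_surjective x
  obtain ⟨t, rfl⟩ := QuotientAddGroup.mk_surjective w
  have h := circleSin_coe k (s + t)
  rw [mul_add, Real.sin_add] at h
  simpa using h

lemma circleCos_add (k : ℤ) (x w : UnitAddCircle) :
    circleCos k (x + w) = circleCos k x * circleCos k w - circleSin k x * circleSin k w := by
  obtain ⟨s, rfl⟩ := QuotientAddGroup.mk_surjective x
  obtain ⟨t, rfl⟩ := QuotientAddGroup.mk_surjective w
  have h := circleCos_coe k (s + t)
  rw [mul_add, Real.cos_add] at h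
  simpa using h

lemma fderiv_phaseOp_trigPrim_even {r : ℝ} (h0 : 0 < r) (h1 : r ≤ 1 / 2) (lam mu : ℝ) (q j : ℕ) :
    fderiv ℝ (phaseOp r lam mu q) 0 (trigPrim (2 * j)) =
      eigenvalueC1 q (j + 1) r lam mu • trigPrim (2 * j) := by
  refine fderiv_phaseOp_eq_smul h0 h1 lam mu q (j + 1) _ (circleSin (j + 1)) (circleCos (j + 1))
    (fun x w => ?_) fun x => ?_
  · rw [trigPrim_even_rep, circleSin_add]; ring
  · rw [trigPrim_even_rep, circleSin_at_zero, sub_zero]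

lemma fderiv_phaseOp_trigPrim_odd {r : ℝ} (h0 : 0 < r) (h1 : r ≤ 1 / 2) (lam mu : ℝ) (q j : ℕ) :
    fderiv ℝ (phaseOp r lam mu q) 0 (trigPrim (2 * j + 1)) =
      eigenvalueC1 q (j + 1) r lam mu • trigPrim (2 * j + 1) := by
  refine fderiv_phaseOp_eq_smul h0 h1 lam mu q (j + 1) _ (fun x => -circleCos (j + 1) x)
    (circleSin (j + 1)) (fun x w => ?_) fun x => ?_
  · simp only [trigPrim_odd_rep, ContinuousMap.sub_apply, ContinuousMap.one_apply, circleCos_add]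
    ring
  · simp only [trigPrim_odd_rep, ContinuousMap.sub_apply, ContinuousMap.one_apply,
      circleCos_at_zero]
    ring

end

theorem mainTheorem6 (lam mu : ℝ) :
    -- the functions `sin(2πkx)`, `1 - cos(2πkx)`, `k = 1, 2, …`, form a Schauder basis of `H¹₀`
    ∃ b : SchauderBasis ℝ H10,
      (∀ (j : ℕ) (x : ℝ),
        (b (2 * j)).rep (x : UnitAddCircle) = Real.sin (2 * Real.pi * (j + 1) * x) ∧
        (b (2 * j + 1)).rep (x : UnitAddCircle) = 1 - Real.cos (2 * Real.pi * (j + 1) * x)) ∧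
    -- constants that depend only on `n`, `lam`, `mu`
    ∃ C : ℕ → ℝ, ∀ (r : ℝ), 0 < r → r ≤ 1 / 2 → ∀ q : ℕ,
      -- `F^q(v) = F(Ψ^q + v)` maps `H¹₀` into itself
      ∃ F : H10 → H10,
        (∀ (v : H10) (x : UnitAddCircle),
          (F v).rep x = phaseRHS r lam mu (perturbedState q v) x) ∧
        -- it is `n` times Fréchet differentiable for every `n`
        ContDiff ℝ ∞ F ∧
        -- and its `n`-th derivative at `v` is `A^Ψ` with `Ψ = Ψ^q + v`
        (∀ (n : ℕ) (v : H10) (η : Fin n → H10) (x : UnitAddCircle),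
          (iteratedFDeriv ℝ n F v η).rep x =
            multilinearOp r lam mu (perturbedState q v) (fun i => (η i).rep) x) ∧
        -- bound in the `H¹` norm
        (∀ (n : ℕ) (v : H10) (η : Fin n → H10),
          ‖iteratedFDeriv ℝ n F v η‖ ^ 2 ≤
            C n * (1 + perturbedStateNormSq q v) * ∏ i, ‖η i‖ ^ 2) ∧
        -- explicit constant without higher-order interactions
        (lam = 0 → mu = 0 → ∀ (n : ℕ) (v : H10) (η : Fin n → H10),
          ‖iteratedFDeriv ℝ n F v η‖ ^ 2 ≤
            (4 + (n + 3) * (n + 2 + perturbedStateNormSq q v)) * ∏ i, ‖η i‖ ^ 2) ∧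
        -- the linearization at the twisted state is diagonal on the basis
        (∀ j : ℕ,
          fderiv ℝ F 0 (b (2 * j)) = eigenvalueC1 q (j + 1) r lam mu • b (2 * j) ∧
          fderiv ℝ F 0 (b (2 * j + 1)) = eigenvalueC1 q (j + 1) r lam mu • b (2 * j + 1)) := by
  refine ⟨trigSchauderBasis, fun j x => ⟨?_, ?_⟩, derivBound lam mu, fun r h0 h1 q =>
    ⟨phaseOp r lam mu q, rep_phaseOp r lam mu q, contDiff_phaseOp r lam mu q,
      fun n v η x => rep_iteratedFDeriv_phaseOp r lam mu q v η x,
      fun n v η => norm_iteratedFDeriv_phaseOp_sq_le r lam mu q v η, ?_,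
      fun j => ⟨fderiv_phaseOp_trigPrim_even h0 h1 lam mu q j,
        fderiv_phaseOp_trigPrim_odd h0 h1 lam mu q j⟩⟩⟩
  · change (trigPrim (2 * j)).rep (x : UnitAddCircle) = _
    rw [trigPrim_even_rep, circleSin_coe]
    push_cast
    rfl
  · change (trigPrim (2 * j + 1)).rep (x : UnitAddCircle) = _
    rw [trigPrim_odd_rep, ContinuousMap.sub_apply, circleCos_coe]
    push_cast
    rfl
  · rintro rfl rfl n v η
    exact norm_iteratedFDeriv_pair_sq_le r q v η
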